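/- **Setting.** Let $\mathcal G$ be a jump-diffusion operator on $\mathbb R$, $$\mathcal G f(x)=b(x)f'(x)+\tfrac12\sigma^2(x)f''(x)+\int_{\mathbb R}\bigl(f(x+z)-f(x)-f'(x)z\bigr)\,\ell(x,dz),$$ with $b,\sigma:\mathbb R\to\mathbb R$ measurable and $\ell$ a transition kernel on $\mathbb R$ such that $\ell(x,\{0\})=0$ and $\int_{\mathbb R}|z|\wedge|z|^2\,\ell(x,dz)<\infty$ for all $x\in\mathbb R$. Assume that $\mathcal G$ is polynomial: $\int_{\mathbb R}|z|^k\,\ell(x,dz)<\infty$ for all $x\in\mathbb R$ and $k\ge2$, and for each $n\in\mathbb N$ the operator $\mathcal G$ maps the space $\mathrm{Pol}_n(\mathbb R)$ of polynomials of degree at most $n$ to itself. Let $(\Omega,\mathcal F,(\mathcal F_t)_{t\ge0},\mathbb P)$ be a filtered probability space and let $Y$ be a real-valued adapted càdlàg process with $Y(0)=y\in\mathbb R$ almost surely and with extended generator $\mathcal G$, i.e. for every bounded $f\in C^2(\mathbb R)$ the process $f(Y(t))-f(y)-\int_0^t\mathcal Gf(Y(s))\,ds$ is a local martingale. For $n\ge0$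 let $H_n(x)=(1,x,\dots,x^n)^\top$ and $X_n(x)=H_n(x)H_n(x)^\top$, and let the generator matrix $G_n\in\mathbb R^{(n+1)\times(n+1)}$ be the unique matrix with $\mathcal GH_n(x)=G_nH_n(x)$ for all $x\in\mathbb R$, where $\mathcal G$ acts entrywise. Let $vec$ denote the operator that stacks the columns of a matrix, with inverse $vec^{-1}$. With $\vec e_{k,j}$ the $j$-th canonical basis vector of $\mathbb R^k$ and $\otimes$ the Kronecker product, put $$E_{n+1}=\sum_{i=1}^{n+1}\vec e_{2n+1,i}\otimes\vec e_{n+1,1}^{\,\top}\otimes\vec e_{n+1,i}^{\,\top}+\sum_{i=2}^{n+1}\vec e_{2n+1,n+i}\otimes\vec e_{n+1,i}^{\,\top}\otimes\vec e_{n+1,n+1}^{\,\top},\qquad D_{n+1}=\sum_{i=1}^{n+1}\sum_{j=1}^{n+1}\vec e_{2n+1,i+j-1}^{\,\top}\otimes\vec e_{n+1,j}\otimes\vec e_{n+1,i}.$$ **Theorem (two-point correlator formula).** Let $p_0\in\mathrm{Pol}_{n_0}(\mathbb R)$, $p_1\in\mathrm{Pol}_{n_1}(\mathbb R)$, $n=\max\{n_0,n_1\}$,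 let $\vec p_0,\vec p_1\in\mathbb R^{n+1}$ be the vectors of coefficients, so that $p_k(x)=\vec p_k^{\,\top}H_n(x)$, and let $0\le t<s_0<s_1$. Then $p_1(Y(s_0))\,p_0(Y(s_1))$ is integrable and, almost surely, $$\mathbb E\bigl[p_1(Y(s_0))\,p_0(Y(s_1))\,\big|\,\mathcal F_t\bigr]=\vec p_1^{\,\top}\Bigl\{vec^{-1}\circ D_{n+1}e^{G_{2n}(s_0-t)}E_{n+1}\circ vec\bigl(X_n(Y(t))\bigr)\Bigr\}e^{G_n^\top(s_1-s_0)}\,\vec p_0 .$$ -/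

import Mathlib

open MeasureTheory ProbabilityTheory Filter Topology
open scoped NNReal Matrix

noncomputable section

/-- The data of a jump-diffusion operator on `ℝ`: a drift `b`, a volatility `σ` and a transition
kernel `ℓ` of jump sizes with `ℓ(x, {0}) = 0` and `∫ |z| ∧ |z|² ℓ(x, dz) < ∞` for all `x`. -/
structure JumpDiffusionOperator where
  b : ℝ → ℝ
  measurable_b : Measurable b
  σ : ℝ → ℝ
  measurable_σ : Measurable σ
  ℓ : Kernel ℝ ℝ
  ℓ_zero : ∀ x, ℓ x {0} = 0
  integrable_ℓ : ∀ x, Integrable (fun z : ℝ => min |z| (|z| ^ 2)) (ℓ x)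

namespace JumpDiffusionOperator

/-- The action of the operator:
`𝒢 f(x) = b(x) f'(x) + ½ σ²(x) f''(x) + ∫ (f(x + z) - f(x) - f'(x) z) ℓ(x, dz)`. -/
def apply (𝒢 : JumpDiffusionOperator) (f : ℝ → ℝ) (x : ℝ) : ℝ :=
  𝒢.b x * deriv f x + 1 / 2 * 𝒢.σ x ^ 2 * deriv (deriv f) x
    + ∫ z, (f (x + z) - f x - deriv f x * z) ∂(𝒢.ℓ x)

/-- `𝒢` is polynomial: it is well defined on polynomials (all moments of order at least two of the
jump kernel are finite; on the state space `ℝ` the further requirement that `𝒢` annihilates the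
zero function holds by definition) and it maps polynomials of degree at most `n` to polynomials of
degree at most `n`, for each `n`. -/
structure IsPolynomial (𝒢 : JumpDiffusionOperator) : Prop where
  integrable_pow : ∀ x, ∀ k : ℕ, 2 ≤ k → Integrable (fun z : ℝ => |z| ^ k) (𝒢.ℓ x)
  mapsTo_degreeLE : ∀ n : ℕ, ∀ p ∈ Polynomial.degreeLE ℝ n, ∃ q ∈ Polynomial.degreeLE ℝ n,
    ∀ x, 𝒢.apply (fun u => p.eval u) x = q.eval x

end JumpDiffusionOperator

/-- The vector of monomials `H_n(x) = (1, x, …, xⁿ)`. -/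
def monomialVec (n : ℕ) (x : ℝ) : Fin (n + 1) → ℝ := fun i => x ^ (i : ℕ)

/-- The vector of coefficients in `ℝ^(n+1)` of a polynomial of degree at most `n`. -/
def coeffVec (n : ℕ) (p : Polynomial ℝ) : Fin (n + 1) → ℝ := fun i => p.coeff i

/-- The Hankel matrix `X_n(x) = H_n(x) H_n(x)ᵀ`. -/
def hankelMatrix (n : ℕ) (x : ℝ) : Matrix (Fin (n + 1)) (Fin (n + 1)) ℝ :=
  Matrix.vecMulVec (monomialVec n x) (monomialVec n x)

namespace JumpDiffusionOperator

theorem IsPolynomial.exists_generatorMatrix {𝒢 : JumpDiffusionOperator} (h : 𝒢.IsPolynomial)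
    (n : ℕ) : ∃ G : Matrix (Fin (n + 1)) (Fin (n + 1)) ℝ,
      ∀ x, (fun i : Fin (n + 1) => 𝒢.apply (fun u => u ^ (i : ℕ)) x) = G *ᵥ monomialVec n x := by
  have key : ∀ i : Fin (n + 1), ∃ q ∈ Polynomial.degreeLE ℝ n,
      ∀ x, 𝒢.apply (fun u => u ^ (i : ℕ)) x = q.eval x := by
    intro i
    have := h.mapsTo_degreeLE n (Polynomial.X ^ (i : ℕ)) (by
      rw [Polynomial.mem_degreeLE, Polynomial.degree_X_pow]
      exact_mod_cast Nat.lt_succ_iff.mp i.2)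
    simpa using this
  choose q hq hqx using key
  refine ⟨Matrix.of fun i j => (q i).coeff j, fun x => funext fun i => ?_⟩
  have hd : (q i).natDegree < n + 1 :=
    Nat.lt_succ_iff.mpr (Polynomial.natDegree_le_of_degree_le (Polynomial.mem_degreeLE.mp (hq i)))
  rw [hqx, Polynomial.eval_eq_sum_range' hd, ← Fin.sum_univ_eq_sum_range
    (fun j => (q i).coeff j * x ^ j)]
  rfl

/-- The generator matrix `G_n` of a polynomial operator: the matrix with `𝒢 H_n(x) = G_n H_n(x)`
for all `x`. -/
def generatorMatrix {𝒢 : JumpDiffusionOperator} (h : 𝒢.IsPolynomial) (n : ℕ) :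
    Matrix (Fin (n + 1)) (Fin (n + 1)) ℝ :=
  (h.exists_generatorMatrix n).choose

theorem generatorMatrix_mulVec {𝒢 : JumpDiffusionOperator} (h : 𝒢.IsPolynomial) (n : ℕ) (x : ℝ) :
    (fun i : Fin (n + 1) => 𝒢.apply (fun u => u ^ (i : ℕ)) x)
      = generatorMatrix h n *ᵥ monomialVec n x :=
  (h.exists_generatorMatrix n).choose_spec x

/-- The generator matrix is the only matrix with its defining property. -/
theorem eq_generatorMatrix {𝒢 : JumpDiffusionOperator} (h : 𝒢.IsPolynomial) (n : ℕ)
    (G : Matrix (Fin (n + 1)) (Fin (n + 1)) ℝ)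
    (hG : ∀ x, (fun i : Fin (n + 1) => 𝒢.apply (fun u => u ^ (i : ℕ)) x)
      = G *ᵥ monomialVec n x) : G = generatorMatrix h n := by
  have aux : ∀ v w : Fin (n + 1) → ℝ,
      (∀ x, v ⬝ᵥ monomialVec n x = w ⬝ᵥ monomialVec n x) → v = w := by
    intro v w hvw
    have hp : (∑ i : Fin (n + 1), Polynomial.monomial (i : ℕ) (v i) : Polynomial ℝ)
        = ∑ i : Fin (n + 1), Polynomial.monomial (i : ℕ) (w i) := by
      refine Polynomial.funext fun x => ?_
      simpa [Polynomial.eval_finsetSum, dotProduct, monomialVec] using hvw x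
    funext i
    have := congrArg (fun p => Polynomial.coeff p (i : ℕ)) hp
    simpa [Polynomial.finsetSum_coeff, Polynomial.coeff_monomial, Fin.val_inj] using this
  funext i
  refine aux _ _ fun x => ?_
  exact congrFun ((hG x).symm.trans (generatorMatrix_mulVec h n x)) i

end JumpDiffusionOperator

/-- `Y` is an adapted càdlàg process which starts in `y` and has extended generator `𝒢`: for every
bounded `f` of class `C²`, the process `f(Y(t)) - f(y) - ∫₀ᵗ 𝒢 f(Y(s)) ds` is a local martingale.
Here `P` plays the role of `ℙ_y`. -/
structure IsJumpDiffusion {Ω : Type*} {mΩ : MeasurableSpace Ω} (𝒢 : JumpDiffusionOperator)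
    (P : Measure Ω) (ℱ : Filtration ℝ≥0 mΩ) (Y : ℝ≥0 → Ω → ℝ) (y : ℝ) : Prop where
  stronglyAdapted : StronglyAdapted ℱ Y
  right_continuous : ∀ ω t, ContinuousWithinAt (fun s => Y s ω) (Set.Ici t) t
  left_limits : ∀ ω t, ∃ l : ℝ, Tendsto (fun s => Y s ω) (𝓝[<] t) (𝓝 l)
  initial : ∀ᵐ ω ∂P, Y 0 ω = y
  local_martingale : ∀ f : ℝ → ℝ, ContDiff ℝ 2 f → (∃ C, ∀ x, |f x| ≤ C) →
    Locally (fun M => Martingale M ℱ P) ℱ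
      (fun t ω => f (Y t ω) - f y - ∫ s in (0 : ℝ)..t, 𝒢.apply f (Y s.toNNReal ω)) P

/-- The inverse `vec⁻¹` of the vectorization `Matrix.vec`, which stacks the columns of a matrix.
Entries of `vec A` are indexed by pairs (column, row), in place of `n (j - 1) + i`. -/
def vecInv {m n : ℕ} (v : Fin n × Fin m → ℝ) : Matrix (Fin m) (Fin n) ℝ :=
  Matrix.of fun i j => v (j, i)

theorem vecInv_vec {m n : ℕ} (A : Matrix (Fin m) (Fin n) ℝ) : vecInv A.vec = A := rfl

/-- The L-eliminating matrix `E_{n+1}`, which sends `vec A` to the first column of `A` followed by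
the last row of `A` without its first entry. A Kronecker product `e_k ⊗ e_jᵀ ⊗ e_iᵀ` of canonical
basis vectors is the matrix unit in row `k` and column `(j, i)`. -/
def elimMatrix (n : ℕ) : Matrix (Fin (2 * n + 1)) (Fin (n + 1) × Fin (n + 1)) ℝ :=
  (∑ i : Fin (n + 1), Matrix.single (⟨i, by omega⟩ : Fin (2 * n + 1)) (0, i) 1)
    + ∑ i : Fin n, Matrix.single (⟨n + 1 + i, by omega⟩ : Fin (2 * n + 1)) (i.succ, Fin.last n) 1

/-- The L-duplicating matrix `D_{n+1}`, the sum of the matrix units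
`e_{i+j-1}ᵀ ⊗ e_j ⊗ e_i` for `1 ≤ i, j ≤ n + 1`. -/
def dupMatrix (n : ℕ) : Matrix (Fin (n + 1) × Fin (n + 1)) (Fin (2 * n + 1)) ℝ :=
  ∑ i : Fin (n + 1), ∑ j : Fin (n + 1),
    Matrix.single (j, i) (⟨i + j, by omega⟩ : Fin (2 * n + 1)) 1

end

noncomputable section

/-! Since `𝒢` preserves degrees, the conditional moments of `Y` solve a closed linear differential
equation, so E[H_n(Y(s)) | ℱ_t] = exp((s - t) G_n) H_n(Y(t)). Conditioning on ℱ_{s₀} turns p₀(Y(s₁))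
into a polynomial of degree at most n in Y(s₀). Its product with p₁ has degree at most 2n, and the
same formula for G_{2n} takes it back to time t. The matrix E reads H_{2n}(x) off X_n(x), and D
spreads a vector v over the Hankel matrix (v_{i+j}), whose bilinear form is the pairing of v with a
product of polynomials.

The work lies in the moment formula, because the local martingale property is given only for bounded
functions. Growth bounds for the drift, the squared volatility and the even jump moments come from
the action of `𝒢` on X and on the powers (X - x)^(2k). Bounded concave functions f of (1 + x²)^k
then satisfy 𝒢 f ≤ c f, and Gronwall and Fatou yield moments of all orders, with exponential control
in time (`exists_moment_le`).

Once moments exist, dominated convergence removes the localisation for bounded functions and then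
passes from the truncations `sinTrunc` to polynomials. The result is Dynkin's formula on each event
A of the past (`setIntegral_eval_eq`). For fixed A the moments over A are ordinary functions of time
that solve a linear integral equation, hence are given by the matrix exponential
(`eq_exp_mulVec_of_integral_eq`); letting A vary gives `condExp_dotProduct_monomialVec`. -/

theorem one_le_one_add_sq (x : ℝ) : 1 ≤ 1 + x ^ 2 := by nlinarith [sq_nonneg x]

theorem one_add_sq_pow_mono (x : ℝ) {a b : ℕ} (h : a ≤ b) : (1 + x ^ 2) ^ a ≤ (1 + x ^ 2) ^ b :=
  pow_le_pow_right₀ (one_le_one_add_sq x) h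

theorem one_add_add_sq_le (x z : ℝ) : 1 + (x + z) ^ 2 ≤ 2 * (1 + x ^ 2) * (1 + z ^ 2) := by
  nlinarith [sq_nonneg (x - z), sq_nonneg (x * z)]

theorem abs_pow_le_one_add_sq_pow (x : ℝ) {i k : ℕ} (h : i ≤ 2 * k) :
    |x ^ i| ≤ (1 + x ^ 2) ^ k := by
  refine abs_le_of_sq_le_sq ?_ (by positivity)
  calc (x ^ i) ^ 2 = (x ^ 2) ^ i := by ring
    _ ≤ (1 + x ^ 2) ^ i := by gcongr; linarith
    _ ≤ (1 + x ^ 2) ^ (2 * k) := one_add_sq_pow_mono x h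
    _ = ((1 + x ^ 2) ^ k) ^ 2 := by ring

/-- A polynomial of degree at most `2 k` is bounded by a multiple of `(1 + x²)ᵏ`. -/
theorem Polynomial.exists_abs_eval_le (q : Polynomial ℝ) {k : ℕ} (h : q.natDegree ≤ 2 * k) :
    ∃ C, 0 ≤ C ∧ ∀ x, |q.eval x| ≤ C * (1 + x ^ 2) ^ k := by
  refine ⟨∑ i ∈ Finset.range (q.natDegree + 1), |q.coeff i|,
    Finset.sum_nonneg fun _ _ => abs_nonneg _, fun x => ?_⟩
  rw [Polynomial.eval_eq_sum_range, Finset.sum_mul]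
  refine (Finset.abs_sum_le_sum_abs _ _).trans (Finset.sum_le_sum fun i hi => ?_)
  rw [abs_mul]
  gcongr
  exact abs_pow_le_one_add_sq_pow x (by have := Finset.mem_range.1 hi; omega)

theorem Polynomial.exists_abs_eval_le' (q : Polynomial ℝ) :
    ∃ C, 0 ≤ C ∧ ∀ x, |q.eval x| ≤ C * (1 + x ^ 2) ^ q.natDegree :=
  q.exists_abs_eval_le (by omega)

theorem le_grid (x : ℝ) (m : ℕ) : x ≤ ((⌊x * (m + 1)⌋ : ℝ) + 1) / (m + 1) := by
  rw [le_div_iff₀ (by positivity)]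
  exact (Int.lt_floor_add_one (x * (m + 1))).le

/-- The points of the grid with mesh `1 / (m + 1)` approximate each point from the right. -/
theorem tendsto_grid (x : ℝ) :
    Tendsto (fun m : ℕ => ((⌊x * (m + 1)⌋ : ℝ) + 1) / (m + 1)) atTop (𝓝 x) := by
  have h1 : Tendsto (fun m : ℕ => x + 1 / ((m : ℝ) + 1)) atTop (𝓝 x) := by
    simpa using tendsto_one_div_add_atTop_nhds_zero_nat.const_add x
  refine tendsto_of_tendsto_of_tendsto_of_le_of_le tendsto_const_nhds h1 (le_grid x) fun m => ?_
  have := Int.floor_le (x * (m + 1))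
  have hm : (0 : ℝ) < m + 1 := by positivity
  rw [div_le_iff₀ hm, add_mul, one_div_mul_cancel hm.ne']
  linarith

/-! ### Functions with polynomially growing derivatives -/

/-- `f` is of class `C²`, with first and second derivatives of at most polynomial growth. -/
structure DerivGrowth (f : ℝ → ℝ) (C : ℝ) (d : ℕ) : Prop where
  contDiff : ContDiff ℝ 2 f
  abs_deriv_le : ∀ x, |deriv f x| ≤ C * (1 + x ^ 2) ^ d
  abs_deriv_deriv_le : ∀ x, |deriv (deriv f) x| ≤ C * (1 + x ^ 2) ^ d

namespace DerivGrowth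

variable {f : ℝ → ℝ} {C : ℝ} {d : ℕ}

theorem nonneg (hf : DerivGrowth f C d) : 0 ≤ C := by
  have := (abs_nonneg _).trans (hf.abs_deriv_le 0)
  simpa using this

theorem differentiable (hf : DerivGrowth f C d) : Differentiable ℝ f :=
  hf.contDiff.differentiable (by norm_num)

theorem contDiff_deriv (hf : DerivGrowth f C d) : ContDiff ℝ 1 (deriv f) := by
  have := hf.contDiff
  rw [show (2 : WithTop ℕ∞) = 1 + 1 by norm_num, contDiff_succ_iff_deriv] at this
  exact this.2.2

theorem differentiable_deriv (hf : DerivGrowth f C d) : Differentiable ℝ (deriv f) :=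
  hf.contDiff_deriv.differentiable (by norm_num)

theorem continuous_deriv_deriv (hf : DerivGrowth f C d) : Continuous (deriv (deriv f)) :=
  hf.contDiff_deriv.continuous_deriv (by norm_num)

/-- The mean value inequality is used twice, with the second derivative bounded between x and x + z.
The weight 1 + x² is submultiplicative up to a factor 2, which separates the bound into a factor in
x and a factor in z that `ℓ` integrates. -/
theorem abs_taylor_le (hf : DerivGrowth f C d) (x z : ℝ) :
    |f (x + z) - f x - deriv f x * z|
      ≤ C * 2 ^ d * (1 + x ^ 2) ^ d * (z ^ 2 * (1 + z ^ 2) ^ d) := by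
  set B := C * (2 * (1 + x ^ 2) * (1 + z ^ 2)) ^ d with hB
  have hC := hf.nonneg
  have hB0 : 0 ≤ B := by positivity
  have hmem : ∀ u ∈ Set.uIcc x (x + z), |u - x| ≤ |z| := fun u hu => by
    have := Set.abs_sub_left_of_mem_uIcc hu
    simpa using this
  have h2 : ∀ u ∈ Set.uIcc x (x + z), ‖deriv (deriv f) u‖ ≤ B := fun u hu => by
    refine (hf.abs_deriv_deriv_le u).trans ?_
    have h := one_add_add_sq_le x (u - x)
    rw [add_sub_cancel] at h
    have h' : (u - x) ^ 2 ≤ z ^ 2 := sq_le_sq.2 (hmem u hu)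
    rw [hB]
    gcongr
    exact h.trans (by gcongr)
  have h1 : ∀ u ∈ Set.uIcc x (x + z), ‖deriv f u - deriv f x‖ ≤ B * |z| := fun u hu => by
    refine ((convex_uIcc x (x + z)).norm_image_sub_le_of_norm_deriv_le
      (fun v _ => hf.differentiable_deriv v) h2 Set.left_mem_uIcc hu).trans ?_
    gcongr
    exact hmem u hu
  have hd : ∀ u, HasDerivAt (fun u => f u - deriv f x * u) (deriv f u - deriv f x) u := fun u => by
    have := (hf.differentiable u).hasDerivAt.fun_sub ((hasDerivAt_id u).const_mul (deriv f x))
    rw [mul_one] at this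
    exact this
  have h0 := (convex_uIcc x (x + z)).norm_image_sub_le_of_norm_hasDerivWithin_le
      (f := fun u => f u - deriv f x * u) (fun u _ => (hd u).hasDerivWithinAt) h1
      Set.left_mem_uIcc Set.right_mem_uIcc
  calc |f (x + z) - f x - deriv f x * z|
      = ‖f (x + z) - deriv f x * (x + z) - (f x - deriv f x * x)‖ := by
        rw [Real.norm_eq_abs]; congr 1; ring
    _ ≤ B * |z| * ‖x + z - x‖ := h0
    _ = B * z ^ 2 := by rw [add_sub_cancel_left, Real.norm_eq_abs, mul_assoc, ← sq, sq_abs]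
    _ = _ := by rw [hB, mul_pow, mul_pow]; ring

end DerivGrowth

theorem Polynomial.deriv_eval (p : Polynomial ℝ) :
    _root_.deriv (fun u => p.eval u) = fun u => p.derivative.eval u :=
  _root_.funext fun _ => Polynomial.deriv p

theorem Polynomial.exists_derivGrowth (p : Polynomial ℝ) :
    ∃ C d, DerivGrowth (fun u => p.eval u) C d := by
  obtain ⟨C, hC, h⟩ := p.derivative.exists_abs_eval_le'
  obtain ⟨C', hC', h'⟩ := p.derivative.derivative.exists_abs_eval_le'
  set d := p.derivative.natDegree
  set d' := p.derivative.derivative.natDegree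
  refine ⟨C + C', d + d', p.contDiff_aeval 2, fun x => ?_, fun x => ?_⟩
  · rw [p.deriv_eval]
    exact (h x).trans (mul_le_mul (by linarith) (one_add_sq_pow_mono x (by omega))
      (by positivity) (by positivity))
  · rw [p.deriv_eval, Polynomial.deriv_eval]
    exact (h' x).trans (mul_le_mul (by linarith) (one_add_sq_pow_mono x (by omega))
      (by positivity) (by positivity))

/-! ### Growth of the coefficients and the action of `𝒢` on unbounded functions -/

namespace JumpDiffusionOperator

variable {𝒢 : JumpDiffusionOperator}

theorem apply_eval (𝒢 : JumpDiffusionOperator) (p : Polynomial ℝ) (x : ℝ) :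
    𝒢.apply (fun u => p.eval u) x = 𝒢.b x * p.derivative.eval x
      + 1 / 2 * 𝒢.σ x ^ 2 * p.derivative.derivative.eval x
      + ∫ z, (p.eval (x + z) - p.eval x - p.derivative.eval x * z) ∂(𝒢.ℓ x) := by
  simp only [apply, Polynomial.deriv_eval]

namespace IsPolynomial

theorem integrable_even_pow (h : 𝒢.IsPolynomial) (x : ℝ) {k : ℕ} (hk : 1 ≤ k) :
    Integrable (fun z : ℝ => z ^ (2 * k)) (𝒢.ℓ x) := by
  refine (h.integrable_pow x (2 * k) (by omega)).congr (ae_of_all _ fun z => ?_)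
  simp only [pow_mul, sq_abs]

theorem sq_mul_one_add_sq_pow_le (z : ℝ) (d : ℕ) :
    z ^ 2 * (1 + z ^ 2) ^ d ≤ 2 ^ d * (z ^ (2 * 1) + z ^ (2 * (d + 1))) := by
  have h := add_pow_le (zero_le_one) (sq_nonneg z) d
  have h2 : (2 : ℝ) ^ (d - 1) ≤ 2 ^ d := pow_le_pow_right₀ one_le_two (by omega)
  calc z ^ 2 * (1 + z ^ 2) ^ d ≤ z ^ 2 * (2 ^ d * (1 ^ d + (z ^ 2) ^ d)) := by
        gcongr
        exact h.trans (by gcongr)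
    _ = _ := by rw [one_pow]; ring

theorem integrable_sq_mul (h : 𝒢.IsPolynomial) (x : ℝ) (d : ℕ) :
    Integrable (fun z : ℝ => z ^ 2 * (1 + z ^ 2) ^ d) (𝒢.ℓ x) := by
  refine (((h.integrable_even_pow x le_rfl).add
    (h.integrable_even_pow x (k := d + 1) (by omega))).const_mul (2 ^ d)).mono'
    (by fun_prop) (ae_of_all _ fun z => ?_)
  rw [Real.norm_of_nonneg (by positivity)]
  exact sq_mul_one_add_sq_pow_le z d

theorem integrable_taylor (h : 𝒢.IsPolynomial) {f : ℝ → ℝ} {C : ℝ} {d : ℕ}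
    (hf : DerivGrowth f C d) (x : ℝ) :
    Integrable (fun z => f (x + z) - f x - deriv f x * z) (𝒢.ℓ x) := by
  refine ((h.integrable_sq_mul x d).const_mul (C * 2 ^ d * (1 + x ^ 2) ^ d)).mono' ?_
    (ae_of_all _ fun z => hf.abs_taylor_le x z)
  have := hf.contDiff.continuous
  exact Continuous.aestronglyMeasurable (by fun_prop)

/-- The action of the operator on polynomials, at a given point, as a linear form. -/
def evalLinear (h : 𝒢.IsPolynomial) (x : ℝ) : Polynomial ℝ →ₗ[ℝ] ℝ where
  toFun p := 𝒢.apply (fun u => p.eval u) x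
  map_add' p q := by
    obtain ⟨C, d, hp⟩ := p.exists_derivGrowth
    obtain ⟨C', d', hq⟩ := q.exists_derivGrowth
    have hi := integral_add (h.integrable_taylor hp x) (h.integrable_taylor hq x)
    simp only [Polynomial.deriv_eval] at hi
    rw [apply_eval, apply_eval, apply_eval]
    simp only [Polynomial.derivative_add, Polynomial.eval_add]
    rw [show ∀ a b c d e f : ℝ, a + b + c + (d + e + f) = a + d + (b + e) + (c + f) from
      fun a b c d e f => by ring, ← hi]
    congr 1
    · ring
    · congr 1; funext z; ring
  map_smul' c p := by
    rw [apply_eval, apply_eval]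
    simp only [Polynomial.derivative_smul, Polynomial.eval_smul,
      smul_eq_mul, RingHom.id_apply, mul_add, ← integral_const_mul]
    congr 1
    · ring
    · congr 1; funext z; ring

theorem evalLinear_apply (h : 𝒢.IsPolynomial) (x : ℝ) (p : Polynomial ℝ) :
    h.evalLinear x p = 𝒢.apply (fun u => p.eval u) x := rfl

open Polynomial in
-- The power (X - x)^(2k) and its first derivative vanish at x, and its second derivative does too
-- unless k = 1. So only the jump moment survives, together with σ² in the quadratic case; both are
-- nonnegative, so a bound on the sum bounds each.
theorem evalLinear_central (h : 𝒢.IsPolynomial) (x : ℝ) (k : ℕ) (hk : 1 ≤ k) :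
    h.evalLinear x ((X - C x) ^ (2 * k))
      = (if k = 1 then 𝒢.σ x ^ 2 else 0) + ∫ z, z ^ (2 * k) ∂(𝒢.ℓ x) := by
  obtain ⟨j, rfl⟩ : ∃ j, k = j + 1 := ⟨k - 1, by omega⟩
  rw [evalLinear_apply, apply_eval]
  rcases j with _ | j
  · simp [derivative_pow]
    ring
  · simp [derivative_pow, derivative_mul, show 2 * (j + 1 + 1) - 1 = 2 * j + 3 by omega]

open Polynomial in
-- The test polynomial moves with x. Expanding it binomially leaves fixed monomials, whose images
-- under `𝒢` are polynomials, with coefficients that are polynomials in x; hence the whole value is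
-- a polynomial in x.
theorem exists_evalLinear_central_le (h : 𝒢.IsPolynomial) (k : ℕ) :
    ∃ K N, 0 ≤ K ∧ ∀ x, |h.evalLinear x ((X - C x) ^ k)| ≤ K * (1 + x ^ 2) ^ N := by
  have key : ∀ i : ℕ, ∃ q : ℝ[X], ∀ x, h.evalLinear x (X ^ i) = q.eval x := fun i => by
    obtain ⟨q, -, hq⟩ := h.mapsTo_degreeLE i (X ^ i) (by simp [mem_degreeLE])
    exact ⟨q, hq⟩
  choose q hq using key
  obtain ⟨K, hK, hKx⟩ := (∑ m ∈ Finset.range (k + 1),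
    (-X) ^ (k - m) * (k.choose m : ℝ[X]) * q m).exists_abs_eval_le'
  refine ⟨K, _, hK, fun x => le_of_eq_of_le ?_ (hKx x)⟩
  congr 1
  rw [sub_eq_add_neg, ← C_neg, add_pow, map_sum, eval_finsetSum]
  refine Finset.sum_congr rfl fun m _ => ?_
  rw [show (X : ℝ[X]) ^ m * C (-x) ^ (k - m) * (k.choose m : ℝ[X])
    = ((-x) ^ (k - m) * (k.choose m : ℝ)) • X ^ m by
      rw [smul_eq_C_mul, C_mul, C_pow, map_natCast]; ring, map_smul, hq]
  simp

theorem exists_abs_b_le (h : 𝒢.IsPolynomial) :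
    ∃ K N, 0 ≤ K ∧ ∀ x, |𝒢.b x| ≤ K * (1 + x ^ 2) ^ N := by
  obtain ⟨q, -, hq⟩ := h.mapsTo_degreeLE 1 Polynomial.X (by simp [Polynomial.mem_degreeLE])
  obtain ⟨K, hK, hKx⟩ := q.exists_abs_eval_le'
  refine ⟨K, q.natDegree, hK, fun x => ?_⟩
  have := hq x
  rw [apply_eval] at this
  simp only [Polynomial.derivative_X, Polynomial.derivative_one, Polynomial.eval_one,
    Polynomial.eval_zero, Polynomial.eval_X, mul_one, mul_zero, add_sub_cancel_left, one_mul,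
    sub_self, integral_zero, add_zero] at this
  rw [this]
  exact hKx x

theorem exists_integral_even_pow_le (h : 𝒢.IsPolynomial) {k : ℕ} (hk : 1 ≤ k) :
    ∃ K N, 0 ≤ K ∧ ∀ x, ∫ z, z ^ (2 * k) ∂(𝒢.ℓ x) ≤ K * (1 + x ^ 2) ^ N := by
  obtain ⟨K, N, hK, hKx⟩ := h.exists_evalLinear_central_le (2 * k)
  refine ⟨K, N, hK, fun x => le_trans ?_ ((le_abs_self _).trans (hKx x))⟩
  rw [h.evalLinear_central x k hk]
  have : 0 ≤ if k = 1 then 𝒢.σ x ^ 2 else 0 := by split_ifs <;> positivity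
  linarith

theorem exists_sq_σ_le (h : 𝒢.IsPolynomial) :
    ∃ K N, 0 ≤ K ∧ ∀ x, 𝒢.σ x ^ 2 ≤ K * (1 + x ^ 2) ^ N := by
  obtain ⟨K, N, hK, hKx⟩ := h.exists_evalLinear_central_le (2 * 1)
  refine ⟨K, N, hK, fun x => le_trans ?_ ((le_abs_self _).trans (hKx x))⟩
  rw [h.evalLinear_central x 1 le_rfl, if_pos rfl]
  have : 0 ≤ ∫ z, z ^ (2 * 1) ∂(𝒢.ℓ x) := integral_nonneg fun z => by
    rw [pow_mul, pow_one]; exact sq_nonneg z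
  linarith

theorem exists_integral_sq_mul_le (h : 𝒢.IsPolynomial) (d : ℕ) :
    ∃ K N, 0 ≤ K ∧ ∀ x, ∫ z, z ^ 2 * (1 + z ^ 2) ^ d ∂(𝒢.ℓ x) ≤ K * (1 + x ^ 2) ^ N := by
  obtain ⟨K, N, hK, hKx⟩ := h.exists_integral_even_pow_le le_rfl
  obtain ⟨K', N', hK', hKx'⟩ := h.exists_integral_even_pow_le (k := d + 1) (by omega)
  refine ⟨2 ^ d * (K + K'), N + N', by positivity, fun x => ?_⟩
  have i1 := h.integrable_even_pow x le_rfl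
  have i2 := h.integrable_even_pow x (k := d + 1) (by omega)
  calc ∫ z, z ^ 2 * (1 + z ^ 2) ^ d ∂(𝒢.ℓ x)
      ≤ ∫ z, 2 ^ d * (z ^ (2 * 1) + z ^ (2 * (d + 1))) ∂(𝒢.ℓ x) :=
        integral_mono (h.integrable_sq_mul x d) ((i1.add i2).const_mul _)
          fun z => sq_mul_one_add_sq_pow_le z d
    _ = 2 ^ d * (∫ z, z ^ (2 * 1) ∂(𝒢.ℓ x) + ∫ z, z ^ (2 * (d + 1)) ∂(𝒢.ℓ x)) := by
        rw [integral_const_mul, integral_add i1 i2]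
    _ ≤ 2 ^ d * (K * (1 + x ^ 2) ^ (N + N') + K' * (1 + x ^ 2) ^ (N + N')) := by
        gcongr
        · exact (hKx x).trans (by gcongr; exacts [one_le_one_add_sq x, by omega])
        · exact (hKx' x).trans (by gcongr; exacts [one_le_one_add_sq x, by omega])
    _ = _ := by ring

/-- The constants depend on d alone, not on f. This uniformity gives one dominating function for a
whole sequence of truncations. -/
theorem exists_abs_apply_le (h : 𝒢.IsPolynomial) (d : ℕ) :
    ∃ K N, 0 ≤ K ∧ ∀ f C, DerivGrowth f C d → ∀ x, |𝒢.apply f x| ≤ C * K * (1 + x ^ 2) ^ N := by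
  obtain ⟨K₁, N₁, hK₁, h₁⟩ := h.exists_abs_b_le
  obtain ⟨K₂, N₂, hK₂, h₂⟩ := h.exists_sq_σ_le
  obtain ⟨K₃, N₃, hK₃, h₃⟩ := h.exists_integral_sq_mul_le d
  refine ⟨K₁ + K₂ + 2 ^ d * K₃, d + N₁ + N₂ + N₃, by positivity, fun f C hf x => ?_⟩
  have hC := hf.nonneg
  have e : ∀ N ≤ N₁ + N₂ + N₃, (1 + x ^ 2) ^ d * (1 + x ^ 2) ^ N
      ≤ (1 + x ^ 2) ^ (d + N₁ + N₂ + N₃) := fun N hN => by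
    rw [← pow_add]; exact one_add_sq_pow_mono x (by omega)
  have b1 : |𝒢.b x * deriv f x| ≤ C * K₁ * (1 + x ^ 2) ^ (d + N₁ + N₂ + N₃) := by
    rw [abs_mul]
    calc _ ≤ (K₁ * (1 + x ^ 2) ^ N₁) * (C * (1 + x ^ 2) ^ d) := by
          gcongr; exacts [h₁ x, hf.abs_deriv_le x]
      _ = C * K₁ * ((1 + x ^ 2) ^ d * (1 + x ^ 2) ^ N₁) := by ring
      _ ≤ _ := by gcongr; exact e _ (by omega)
  have b2 : |1 / 2 * 𝒢.σ x ^ 2 * deriv (deriv f) x|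
      ≤ C * K₂ * (1 + x ^ 2) ^ (d + N₁ + N₂ + N₃) := by
    rw [abs_mul, abs_of_nonneg (by positivity : 0 ≤ 1 / 2 * 𝒢.σ x ^ 2)]
    calc _ ≤ (K₂ * (1 + x ^ 2) ^ N₂) * (C * (1 + x ^ 2) ^ d) := by
          refine mul_le_mul ?_ (hf.abs_deriv_deriv_le x) (abs_nonneg _) (by positivity)
          have := h₂ x
          have := sq_nonneg (𝒢.σ x)
          linarith
      _ = C * K₂ * ((1 + x ^ 2) ^ d * (1 + x ^ 2) ^ N₂) := by ring
      _ ≤ _ := by gcongr; exact e _ (by omega)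
  have b3 : |∫ z, (f (x + z) - f x - deriv f x * z) ∂(𝒢.ℓ x)|
      ≤ C * (2 ^ d * K₃) * (1 + x ^ 2) ^ (d + N₁ + N₂ + N₃) := by
    rw [← Real.norm_eq_abs]
    calc _ ≤ ∫ z, C * 2 ^ d * (1 + x ^ 2) ^ d * (z ^ 2 * (1 + z ^ 2) ^ d) ∂(𝒢.ℓ x) :=
          norm_integral_le_of_norm_le ((h.integrable_sq_mul x d).const_mul _)
            (ae_of_all _ fun z => hf.abs_taylor_le x z)
      _ ≤ C * 2 ^ d * (1 + x ^ 2) ^ d * (K₃ * (1 + x ^ 2) ^ N₃) := by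
          rw [integral_const_mul]; gcongr; exact h₃ x
      _ = C * (2 ^ d * K₃) * ((1 + x ^ 2) ^ d * (1 + x ^ 2) ^ N₃) := by ring
      _ ≤ _ := by gcongr; exact e _ (by omega)
  have := (abs_add_le _ _).trans (add_le_add ((abs_add_le _ _).trans (add_le_add b1 b2)) b3)
  rw [apply]
  exact this.trans (le_of_eq (by ring))

theorem tendsto_apply (h : 𝒢.IsPolynomial) {F : ℕ → ℝ → ℝ} {f : ℝ → ℝ} {C : ℝ} {d : ℕ}
    (hF : ∀ m, DerivGrowth (F m) C d) (h0 : ∀ x, Tendsto (fun m => F m x) atTop (𝓝 (f x)))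
    (h1 : ∀ x, Tendsto (fun m => deriv (F m) x) atTop (𝓝 (deriv f x)))
    (h2 : ∀ x, Tendsto (fun m => deriv (deriv (F m)) x) atTop (𝓝 (deriv (deriv f) x))) (x : ℝ) :
    Tendsto (fun m => 𝒢.apply (F m) x) atTop (𝓝 (𝒢.apply f x)) := by
  refine (((h1 x).const_mul _).add ((h2 x).const_mul _)).add ?_
  refine tendsto_integral_of_dominated_convergence _
    (fun m => (h.integrable_taylor (hF m) x).aestronglyMeasurable)
    ((h.integrable_sq_mul x d).const_mul (C * 2 ^ d * (1 + x ^ 2) ^ d))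
    (fun m => ae_of_all _ fun z => (hF m).abs_taylor_le x z)
    (ae_of_all _ fun z => ((h0 _).sub (h0 _)).sub ((h1 x).mul_const z))

/-- The integrand of the jump part depends on x as well, and `ℓ` need not be s-finite. With the base
point frozen, the integral is measurable in the kernel's argument; a base point on a grid takes
countably many values, and refining the grid gives the claim by dominated convergence. -/
theorem measurable_apply (h : 𝒢.IsPolynomial) {f : ℝ → ℝ} {C : ℝ} {d : ℕ}
    (hf : DerivGrowth f C d) : Measurable (𝒢.apply f) := by
  have hc := hf.contDiff.continuous
  have hc1 := hf.contDiff_deriv.continuous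
  refine ((𝒢.measurable_b.mul hc1.measurable).add
    (((𝒢.measurable_σ.pow_const 2).const_mul _).mul
      hf.continuous_deriv_deriv.measurable)).add ?_
  let H : ℝ → ℝ → ℝ := fun a x => ∫ z, (f (a + z) - f a - deriv f a * z) ∂(𝒢.ℓ x)
  have hH : ∀ a, Measurable (H a) := fun a =>
    (StronglyMeasurable.integral_kernel
      (f := fun z => f (a + z) - f a - deriv f a * z)
      (Continuous.stronglyMeasurable (by fun_prop))).measurable
  have hm : ∀ m : ℕ, Measurable fun x : ℝ => H (((⌊x * (m + 1)⌋ : ℝ) + 1) / (m + 1)) x := fun m => by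
    have : Measurable fun q : ℤ × ℝ => H (((q.1 : ℝ) + 1) / ((m : ℝ) + 1)) q.2 :=
      measurable_from_prod_countable_right fun k => hH (((k : ℝ) + 1) / ((m : ℝ) + 1))
    exact this.comp ((Int.measurable_floor.comp (measurable_id.mul_const _)).prodMk measurable_id)
  refine measurable_of_tendsto_metrizable hm (tendsto_pi_nhds.2 fun x => ?_)
  have hx := tendsto_grid x
  obtain ⟨B, hB⟩ : ∃ B, ∀ m : ℕ,
      (1 + (((⌊x * (m + 1)⌋ : ℝ) + 1) / (m + 1)) ^ 2) ^ d ≤ B := by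
    obtain ⟨B, hB⟩ := ((hx.pow 2).const_add 1 |>.pow d).bddAbove_range
    exact ⟨B, fun m => hB ⟨m, rfl⟩⟩
  have hC := hf.nonneg
  refine tendsto_integral_of_dominated_convergence (fun z => C * 2 ^ d * B *
      (z ^ 2 * (1 + z ^ 2) ^ d))
    (fun m => Continuous.aestronglyMeasurable (by fun_prop))
    ((h.integrable_sq_mul x d).const_mul _)
    (fun m => ae_of_all _ fun z => (hf.abs_taylor_le _ z).trans (by gcongr; exact hB m))
    (ae_of_all _ fun z => ?_)
  exact (((hc.tendsto _).comp (hx.add_const z)).sub ((hc.tendsto _).comp hx)).sub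
    (((hc1.tendsto _).comp hx).mul_const z)

end IsPolynomial

end JumpDiffusionOperator

/-! ### Bounded approximations of polynomials -/

section ConcaveTrunc

/-- The composition of `p` with the bounded concave function `v ↦ m - m² / (m + v) = m v / (m + v)`
on the half-line. -/
def concaveTrunc (m : ℝ) (p : Polynomial ℝ) (x : ℝ) : ℝ := m - m ^ 2 / (m + p.eval x)

variable {m : ℝ} {p : Polynomial ℝ}

theorem deriv_concaveTrunc (hm : 0 < m) (hp : ∀ x, 1 ≤ p.eval x) :
    deriv (concaveTrunc m p) = fun x => m ^ 2 / (m + p.eval x) ^ 2 * p.derivative.eval x := by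
  funext x
  have h0 : m + p.eval x ≠ 0 := by have := hp x; positivity
  have h := ((((p.hasDerivAt x).const_add m).inv h0).const_mul (m ^ 2)).const_sub m
  have h' : HasDerivAt (concaveTrunc m p) _ x := h
  rw [h'.deriv]
  field_simp

theorem deriv_deriv_concaveTrunc (hm : 0 < m) (hp : ∀ x, 1 ≤ p.eval x) :
    deriv (deriv (concaveTrunc m p)) = fun x =>
      m ^ 2 / (m + p.eval x) ^ 2 * p.derivative.derivative.eval x
        - 2 * (m ^ 2 / (m + p.eval x) ^ 3) * p.derivative.eval x ^ 2 := by
  rw [deriv_concaveTrunc hm hp]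
  funext x
  have h0 : m + p.eval x ≠ 0 := by have := hp x; positivity
  have h := ((((((p.hasDerivAt x).const_add m).pow 2).inv (pow_ne_zero 2 h0)).const_mul
    (m ^ 2))).mul (p.derivative.hasDerivAt x)
  have h' : HasDerivAt (fun x => m ^ 2 / (m + p.eval x) ^ 2 * p.derivative.eval x) _ x := h
  rw [h'.deriv]
  simp only [Pi.pow_apply, Pi.inv_apply]
  field_simp
  ring

theorem concaveTrunc_nonneg (hm : 0 < m) (hp : ∀ x, 1 ≤ p.eval x) (x : ℝ) :
    0 ≤ concaveTrunc m p x := by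
  have h := hp x
  rw [concaveTrunc, sub_nonneg, div_le_iff₀ (by positivity)]
  nlinarith

theorem concaveTrunc_le (hm : 0 < m) (hp : ∀ x, 1 ≤ p.eval x) (x : ℝ) :
    concaveTrunc m p x ≤ m := by
  have h := hp x
  have : 0 ≤ m ^ 2 / (m + p.eval x) := by positivity
  rw [concaveTrunc]; linarith

theorem concaveTrunc_le_eval (hm : 0 < m) (hp : ∀ x, 1 ≤ p.eval x) (x : ℝ) :
    concaveTrunc m p x ≤ p.eval x := by
  have h := hp x
  rw [concaveTrunc, sub_le_iff_le_add, ← sub_le_iff_le_add', le_div_iff₀ (by positivity)]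
  nlinarith

theorem tendsto_concaveTrunc (x : ℝ) (hp : ∀ x, 1 ≤ p.eval x) :
    Tendsto (fun j : ℕ => concaveTrunc ((j : ℝ) + 1) p x) atTop (𝓝 (p.eval x)) := by
  have h1 : Tendsto (fun j : ℕ => p.eval x / (1 + p.eval x * (1 / ((j : ℝ) + 1)))) atTop
      (𝓝 (p.eval x / (1 + p.eval x * 0))) :=
    tendsto_const_nhds.div
      ((tendsto_one_div_add_atTop_nhds_zero_nat.const_mul (p.eval x)).const_add 1) (by simp)
  simp only [mul_zero, add_zero, div_one] at h1
  refine h1.congr fun j => ?_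
  have := hp x
  have : (0 : ℝ) < j + 1 := by positivity
  have : (0 : ℝ) < j + 1 + p.eval x := by positivity
  rw [concaveTrunc]
  field_simp
  ring

theorem exists_derivGrowth_concaveTrunc (hm : 0 < m) (hp : ∀ x, 1 ≤ p.eval x) :
    ∃ C d, DerivGrowth (concaveTrunc m p) C d := by
  obtain ⟨C₁, hC₁, h₁⟩ := p.derivative.exists_abs_eval_le'
  obtain ⟨C₂, hC₂, h₂⟩ := p.derivative.derivative.exists_abs_eval_le'
  obtain ⟨C₃, hC₃, h₃⟩ := (p.derivative ^ 2).exists_abs_eval_le'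
  set d₁ := p.derivative.natDegree
  set d₂ := p.derivative.derivative.natDegree
  set d₃ := (p.derivative ^ 2).natDegree
  have e : ∀ x : ℝ, ∀ d ≤ d₁ + d₂ + d₃, (1 + x ^ 2) ^ d ≤ (1 + x ^ 2) ^ (d₁ + d₂ + d₃) :=
    fun x d hd => one_add_sq_pow_mono x hd
  have w2 : ∀ x, |m ^ 2 / (m + p.eval x) ^ 2| ≤ 1 := fun x => by
    have := hp x
    rw [abs_of_nonneg (by positivity)]
    exact div_le_one_of_le₀ (by gcongr; linarith) (by positivity)
  have w3 : ∀ x, |m ^ 2 / (m + p.eval x) ^ 3| ≤ 1 := fun x => by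
    have := hp x
    rw [abs_of_nonneg (by positivity)]
    refine div_le_one_of_le₀ ?_ (by positivity)
    calc m ^ 2 = m ^ 2 * 1 := by ring
      _ ≤ (m + p.eval x) ^ 2 * (m + p.eval x) := by gcongr <;> linarith
      _ = _ := by ring
  refine ⟨C₁ + C₂ + 2 * C₃, d₁ + d₂ + d₃, ?_, fun x => ?_, fun x => ?_⟩
  · refine contDiff_const.sub (contDiff_const.div (contDiff_const.add (p.contDiff_aeval 2))
      fun x => ?_)
    have : 1 ≤ p.aeval x := hp x
    positivity
  · rw [deriv_concaveTrunc hm hp, abs_mul]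
    calc _ ≤ 1 * (C₁ * (1 + x ^ 2) ^ d₁) := by
          gcongr
          exacts [w2 x, h₁ x]
      _ ≤ (C₁ + C₂ + 2 * C₃) * (1 + x ^ 2) ^ (d₁ + d₂ + d₃) := by
          rw [one_mul]
          gcongr
          exacts [by linarith, one_le_one_add_sq x, by omega]
  · rw [deriv_deriv_concaveTrunc hm hp]
    refine (abs_sub _ _).trans ?_
    have h₃' := h₃ x
    rw [Polynomial.eval_pow] at h₃'
    rw [abs_mul, abs_mul, abs_mul, abs_two]
    calc _ ≤ 1 * (C₂ * (1 + x ^ 2) ^ d₂) + 2 * 1 * (C₃ * (1 + x ^ 2) ^ d₃) := by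
          gcongr
          exacts [w2 x, h₂ x, w3 x]
      _ ≤ 1 * (C₂ * (1 + x ^ 2) ^ (d₁ + d₂ + d₃))
          + 2 * 1 * (C₃ * (1 + x ^ 2) ^ (d₁ + d₂ + d₃)) := by
          gcongr 1 * (C₂ * ?_) + 2 * 1 * (C₃ * ?_)
          exacts [e x _ (by omega), e x _ (by omega)]
      _ ≤ _ := by
          have : 0 ≤ C₁ * (1 + x ^ 2) ^ (d₁ + d₂ + d₃) := by positivity
          linarith

/-- With φ(v) = m v / (m + v), this is 𝒢(φ ∘ p) ≤ φ'(p) 𝒢 p. Concavity enters twice: φ lies below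
its tangent at p(x), which handles the jumps, and φ'' ≤ 0, which handles the diffusion. -/
theorem JumpDiffusionOperator.IsPolynomial.apply_concaveTrunc_le {𝒢 : JumpDiffusionOperator}
    (h : 𝒢.IsPolynomial) (hm : 0 < m) (hp : ∀ x, 1 ≤ p.eval x) (x : ℝ) :
    𝒢.apply (concaveTrunc m p) x
      ≤ m ^ 2 / (m + p.eval x) ^ 2 * 𝒢.apply (fun u => p.eval u) x := by
  obtain ⟨C, d, hf⟩ := exists_derivGrowth_concaveTrunc hm hp
  obtain ⟨C', d', hv⟩ := p.exists_derivGrowth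
  have i1 := h.integrable_taylor hf x
  have i2 := (h.integrable_taylor hv x).const_mul (m ^ 2 / (m + p.eval x) ^ 2)
  have hx := hp x
  have hi : ∫ z, (concaveTrunc m p (x + z) - concaveTrunc m p x
        - deriv (concaveTrunc m p) x * z) ∂(𝒢.ℓ x)
      ≤ m ^ 2 / (m + p.eval x) ^ 2
        * ∫ z, (p.eval (x + z) - p.eval x - p.derivative.eval x * z) ∂(𝒢.ℓ x) := by
    rw [← integral_const_mul]
    simp only [p.deriv_eval] at i2
    refine integral_mono i1 i2 fun z => ?_
    have hz := hp (x + z)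
    simp only [deriv_concaveTrunc hm hp, concaveTrunc]
    -- The gap between the tangent at p(x) and φ, in closed form.
    have : m ^ 2 / (m + p.eval x) ^ 2 * (p.eval (x + z) - p.eval x)
        - (m ^ 2 / (m + p.eval x) - m ^ 2 / (m + p.eval (x + z)))
        = m ^ 2 * (p.eval (x + z) - p.eval x) ^ 2
          / ((m + p.eval x) ^ 2 * (m + p.eval (x + z))) := by
      have : m + p.eval x ≠ 0 := by positivity
      have : m + p.eval (x + z) ≠ 0 := by positivity
      field_simp
      ring
    have h0 : 0 ≤ m ^ 2 * (p.eval (x + z) - p.eval x) ^ 2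
          / ((m + p.eval x) ^ 2 * (m + p.eval (x + z))) := by positivity
    linarith
  rw [apply_eval, JumpDiffusionOperator.apply, deriv_deriv_concaveTrunc hm hp]
  rw [deriv_concaveTrunc hm hp] at hi ⊢
  have h2 : 0 ≤ 1 / 2 * 𝒢.σ x ^ 2
      * (2 * (m ^ 2 / (m + p.eval x) ^ 3) * p.derivative.eval x ^ 2) := by positivity
  linarith

end ConcaveTrunc

section SinTrunc

/-- The composition of `p` with the bounded function `x ↦ a sin (x / a)`. -/
def sinTrunc (a : ℝ) (p : Polynomial ℝ) (x : ℝ) : ℝ := p.eval (a * Real.sin (x / a))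

variable {a : ℝ}

theorem hasDerivAt_sinTrunc (ha : a ≠ 0) (p : Polynomial ℝ) (x : ℝ) :
    HasDerivAt (sinTrunc a p) (sinTrunc a p.derivative x * Real.cos (x / a)) x := by
  have h : HasDerivAt (fun x => a * Real.sin (x / a)) (Real.cos (x / a)) x := by
    have := (((hasDerivAt_id x).div_const a).sin).const_mul a
    simp only [id] at this
    exact this.congr_deriv (by field_simp)
  exact (p.hasDerivAt _).comp x h

theorem deriv_sinTrunc (ha : a ≠ 0) (p : Polynomial ℝ) :
    deriv (sinTrunc a p) = fun x => sinTrunc a p.derivative x * Real.cos (x / a) :=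
  funext fun x => (hasDerivAt_sinTrunc ha p x).deriv

theorem deriv_deriv_sinTrunc (ha : a ≠ 0) (p : Polynomial ℝ) :
    deriv (deriv (sinTrunc a p)) = fun x =>
      sinTrunc a p.derivative.derivative x * Real.cos (x / a) ^ 2
        - sinTrunc a p.derivative x * (Real.sin (x / a) / a) := by
  rw [deriv_sinTrunc ha]
  funext x
  have h : HasDerivAt (fun x => Real.cos (x / a)) (-(Real.sin (x / a) / a)) x := by
    have := ((hasDerivAt_id x).div_const a).cos
    simp only [id] at this
    exact this.congr_deriv (by ring)
  rw [((hasDerivAt_sinTrunc ha p.derivative x).fun_mul h).deriv]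
  ring

theorem abs_mul_sin_div_le (ha : 0 < a) (x : ℝ) : |a * Real.sin (x / a)| ≤ |x| := by
  rw [abs_mul, abs_of_pos ha]
  calc a * |Real.sin (x / a)| ≤ a * |x / a| := mul_le_mul_of_nonneg_left Real.abs_sin_le_abs ha.le
    _ = |x| := by rw [abs_div, abs_of_pos ha]; field_simp

theorem abs_sinTrunc_le (ha : 0 < a) {p : Polynomial ℝ} {C : ℝ} (hC : 0 ≤ C) {d : ℕ}
    (hp : ∀ x, |p.eval x| ≤ C * (1 + x ^ 2) ^ d) (x : ℝ) :
    |sinTrunc a p x| ≤ C * (1 + x ^ 2) ^ d := by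
  refine (hp _).trans ?_
  have := sq_le_sq.2 (abs_mul_sin_div_le ha x)
  gcongr

theorem exists_abs_sinTrunc_le (a : ℝ) (p : Polynomial ℝ) : ∃ B, ∀ x, |sinTrunc a p x| ≤ B := by
  obtain ⟨C, hC, h⟩ := p.exists_abs_eval_le'
  refine ⟨C * (1 + a ^ 2) ^ p.natDegree, fun x => (h _).trans ?_⟩
  have : (a * Real.sin (x / a)) ^ 2 ≤ a ^ 2 := by
    rw [mul_pow]
    nlinarith [Real.sin_sq_le_one (x / a), sq_nonneg a]
  gcongr C * (1 + ?_) ^ _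

/-- Uniformity in a comes from |a sin(x / a)| ≤ |x|, while a ≥ 1 controls the term sin(x / a) / a of
the second derivative. -/
theorem exists_derivGrowth_sinTrunc (p : Polynomial ℝ) :
    ∃ C d, ∀ a, 1 ≤ a → DerivGrowth (sinTrunc a p) C d := by
  obtain ⟨C₁, hC₁, h₁⟩ := p.derivative.exists_abs_eval_le'
  obtain ⟨C₂, hC₂, h₂⟩ := p.derivative.derivative.exists_abs_eval_le'
  set d₁ := p.derivative.natDegree
  set d₂ := p.derivative.derivative.natDegree
  refine ⟨C₁ + C₂, d₁ + d₂, fun a ha => ⟨?_, fun x => ?_, fun x => ?_⟩⟩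
  · exact (p.contDiff_aeval 2).comp
      (contDiff_const.mul (Real.contDiff_sin.comp (contDiff_id.div_const a)))
  · have ha0 : 0 < a := by linarith
    rw [deriv_sinTrunc ha0.ne', abs_mul]
    calc _ ≤ C₁ * (1 + x ^ 2) ^ d₁ * 1 := by
          gcongr
          exacts [abs_sinTrunc_le ha0 hC₁ h₁ x, Real.abs_cos_le_one _]
      _ ≤ _ := by
          rw [mul_one]
          gcongr
          exacts [by linarith, one_le_one_add_sq x, by omega]
  · have ha0 : 0 < a := by linarith
    rw [deriv_deriv_sinTrunc ha0.ne']
    refine (abs_sub _ _).trans ?_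
    rw [abs_mul, abs_mul, abs_pow]
    have hs : |Real.sin (x / a) / a| ≤ 1 := by
      rw [abs_div, abs_of_pos ha0]
      exact div_le_one_of_le₀ ((Real.abs_sin_le_one _).trans ha) ha0.le
    calc _ ≤ C₂ * (1 + x ^ 2) ^ d₂ * 1 ^ 2 + C₁ * (1 + x ^ 2) ^ d₁ * 1 := by
          gcongr
          exacts [abs_sinTrunc_le ha0 hC₂ h₂ x, Real.abs_cos_le_one _,
            abs_sinTrunc_le ha0 hC₁ h₁ x]
      _ ≤ C₂ * (1 + x ^ 2) ^ (d₁ + d₂) * 1 ^ 2 + C₁ * (1 + x ^ 2) ^ (d₁ + d₂) * 1 := by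
          gcongr C₂ * ?_ * 1 ^ 2 + C₁ * ?_ * 1
          exacts [one_add_sq_pow_mono x (by omega), one_add_sq_pow_mono x (by omega)]
      _ = _ := by ring

theorem tendsto_div_nat (x : ℝ) : Tendsto (fun j : ℕ => x / ((j : ℝ) + 1)) atTop (𝓝 0) := by
  simpa [div_eq_mul_inv] using (tendsto_one_div_add_atTop_nhds_zero_nat (𝕜 := ℝ)).const_mul x

theorem tendsto_sinTrunc (p : Polynomial ℝ) (x : ℝ) :
    Tendsto (fun j : ℕ => sinTrunc ((j : ℝ) + 1) p x) atTop (𝓝 (p.eval x)) := by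
  refine (p.continuous.tendsto x).comp ?_
  -- Here a sin(x / a) = x sinc(x / a), so continuity of sinc at 0 suffices.
  have h : Tendsto (fun j : ℕ => x * Real.sinc (x / ((j : ℝ) + 1))) atTop (𝓝 (x * 1)) := by
    refine Tendsto.const_mul x ?_
    have := (Real.continuous_sinc.tendsto 0).comp (tendsto_div_nat x)
    rwa [Real.sinc_zero] at this
  rw [mul_one] at h
  refine h.congr fun j => ?_
  have hj : (0 : ℝ) < j + 1 := by positivity
  rcases eq_or_ne x 0 with rfl | hx
  · simp
  · rw [Real.sinc_of_ne_zero (by positivity)]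
    field_simp

theorem tendsto_deriv_sinTrunc (p : Polynomial ℝ) (x : ℝ) :
    Tendsto (fun j : ℕ => deriv (sinTrunc ((j : ℝ) + 1) p) x) atTop
      (𝓝 (deriv (fun u => p.eval u) x)) := by
  have hcos : Tendsto (fun j : ℕ => Real.cos (x / ((j : ℝ) + 1))) atTop (𝓝 1) := by
    have := (Real.continuous_cos.tendsto 0).comp (tendsto_div_nat x)
    rwa [Real.cos_zero] at this
  have h := (tendsto_sinTrunc p.derivative x).mul hcos
  rw [mul_one] at h
  rw [p.deriv_eval]
  refine h.congr fun j => ?_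
  rw [deriv_sinTrunc (by positivity)]

theorem tendsto_deriv_deriv_sinTrunc (p : Polynomial ℝ) (x : ℝ) :
    Tendsto (fun j : ℕ => deriv (deriv (sinTrunc ((j : ℝ) + 1) p)) x) atTop
      (𝓝 (deriv (deriv (fun u => p.eval u)) x)) := by
  have hcos : Tendsto (fun j : ℕ => Real.cos (x / ((j : ℝ) + 1))) atTop (𝓝 1) := by
    have := (Real.continuous_cos.tendsto 0).comp (tendsto_div_nat x)
    rwa [Real.cos_zero] at this
  have hsin : Tendsto (fun j : ℕ => Real.sin (x / ((j : ℝ) + 1)) / ((j : ℝ) + 1)) atTop (𝓝 0) := by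
    have h0 : Tendsto (fun j : ℕ => Real.sin (x / ((j : ℝ) + 1))) atTop (𝓝 0) := by
      rw [← Real.sin_zero]
      exact (Real.continuous_sin.tendsto 0).comp (tendsto_div_nat x)
    simpa [div_eq_mul_inv] using h0.mul tendsto_one_div_add_atTop_nhds_zero_nat
  have h := ((tendsto_sinTrunc p.derivative.derivative x).mul (hcos.pow 2)).sub
    ((tendsto_sinTrunc p.derivative x).mul hsin)
  rw [one_pow, mul_one, mul_zero, sub_zero] at h
  rw [p.deriv_eval, p.derivative.deriv_eval]
  refine h.congr fun j => ?_
  rw [deriv_deriv_sinTrunc (by positivity)]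

end SinTrunc

/-! ### Sample paths -/

namespace IsJumpDiffusion

variable {Ω : Type*} {mΩ : MeasurableSpace Ω} {𝒢 : JumpDiffusionOperator} {P : Measure Ω}
  {ℱ : Filtration ℝ≥0 mΩ} {Y : ℝ≥0 → Ω → ℝ} {y : ℝ}

theorem measurable (hY : IsJumpDiffusion 𝒢 P ℱ Y y) (t : ℝ≥0) : Measurable (Y t) :=
  ((hY.stronglyAdapted t).mono (ℱ.le t)).measurable

/-- A left limit and right continuity bound the path near each time; compactness of [0, T] makes the
bound global. -/
theorem exists_abs_le (hY : IsJumpDiffusion 𝒢 P ℱ Y y) (T : ℝ≥0) (ω : Ω) :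
    ∃ B, ∀ s ≤ T, |Y s ω| ≤ B := by
  have key : ∃ B, ∀ s ∈ Set.Icc 0 T, |Y s ω| ≤ B := by
    refine isCompact_Icc.induction_on (p := fun S => ∃ B, ∀ s ∈ S, |Y s ω| ≤ B)
      ⟨0, by simp⟩ (fun S S' hS ⟨B, hB⟩ => ⟨B, fun s hs => hB s (hS hs)⟩) ?_ fun t _ => ?_
    · rintro S S' ⟨B, hB⟩ ⟨B', hB'⟩
      refine ⟨max B B', fun s hs => ?_⟩
      rcases hs with hs | hs
      exacts [(hB s hs).trans (le_max_left _ _), (hB' s hs).trans (le_max_right _ _)]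
    · obtain ⟨l, hl⟩ := hY.left_limits ω t
      have hr := hY.right_continuous ω t
      have e1 : ∀ᶠ s in 𝓝[<] t, |Y s ω| < |l| + 1 := hl.abs.eventually_lt_const (by linarith)
      have e2 : ∀ᶠ s in 𝓝[≥] t, |Y s ω| < |Y t ω| + 1 :=
        (Tendsto.abs hr).eventually_lt_const (by linarith)
      have e : ∀ᶠ s in 𝓝 t, |Y s ω| ≤ |l| + 1 + (|Y t ω| + 1) := by
        rw [← nhdsLT_sup_nhdsGE t, eventually_sup]
        have := abs_nonneg l
        have := abs_nonneg (Y t ω)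
        exact ⟨e1.mono fun s hs => by linarith, e2.mono fun s hs => by linarith⟩
      exact ⟨_, mem_nhdsWithin_of_mem_nhds e, _, fun s hs => hs⟩
  obtain ⟨B, hB⟩ := key
  exact ⟨B, fun s hs => hB s ⟨zero_le, hs⟩⟩

/-- The grid approximates each time from the right, so right continuity alone gives the convergence.
-/
theorem measurable_uncurry (hY : IsJumpDiffusion 𝒢 P ℱ Y y) :
    Measurable fun q : ℝ × Ω => Y q.1.toNNReal q.2 := by
  have hm : ∀ m : ℕ, Measurable fun q : ℝ × Ω =>
      Y (((⌊q.1 * (m + 1)⌋ : ℝ) + 1) / (m + 1)).toNNReal q.2 := fun m => by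
    have : Measurable fun q : ℤ × Ω => Y (((q.1 : ℝ) + 1) / ((m : ℝ) + 1)).toNNReal q.2 :=
      measurable_from_prod_countable_right fun k =>
        hY.measurable (((k : ℝ) + 1) / ((m : ℝ) + 1)).toNNReal
    exact this.comp
      ((Int.measurable_floor.comp (measurable_fst.mul_const _)).prodMk measurable_snd)
  refine measurable_of_tendsto_metrizable hm (tendsto_pi_nhds.2 fun q => ?_)
  have h1 : Tendsto (fun m : ℕ => (((⌊q.1 * (m + 1)⌋ : ℝ) + 1) / (m + 1)).toNNReal) atTop
      (𝓝[≥] q.1.toNNReal) := by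
    refine tendsto_nhdsWithin_iff.2 ⟨(continuous_real_toNNReal.tendsto _).comp (tendsto_grid q.1),
      Eventually.of_forall fun m => Real.toNNReal_le_toNNReal (le_grid q.1 m)⟩
  exact Tendsto.comp (hY.right_continuous q.2 q.1.toNNReal) h1

theorem intervalIntegrable (hY : IsJumpDiffusion 𝒢 P ℱ Y y) {g : ℝ → ℝ} (hg : Measurable g)
    {K : ℝ} {N : ℕ} (hK : ∀ x, |g x| ≤ K * (1 + x ^ 2) ^ N) (a b : ℝ) (ω : Ω) :
    IntervalIntegrable (fun s : ℝ => g (Y s.toNNReal ω)) volume a b := by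
  obtain ⟨B, hB⟩ := hY.exists_abs_le (max a b).toNNReal ω
  have hK0 : 0 ≤ K := by simpa using (abs_nonneg _).trans (hK 0)
  rw [intervalIntegrable_iff]
  refine Measure.integrableOn_of_bounded (M := K * (1 + B ^ 2) ^ N) (by simp)
    (hg.comp (hY.measurable_uncurry.comp measurable_prodMk_right)).aestronglyMeasurable ?_
  refine (ae_restrict_iff' measurableSet_uIoc).2 (ae_of_all _ fun s hs => (hK _).trans ?_)
  have : (Y s.toNNReal ω) ^ 2 ≤ B ^ 2 :=
    sq_le_sq.2 ((hB _ (Real.toNNReal_le_toNNReal hs.2)).trans (le_abs_self B))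
  gcongr

end IsJumpDiffusion

/-! ### A form of Fatou's lemma -/

theorem integrable_and_integral_le_of_tendsto {Ω : Type*} {mΩ : MeasurableSpace Ω} {P : Measure Ω}
    [IsProbabilityMeasure P] {X : ℕ → Ω → ℝ} {Z : Ω → ℝ} {c K : ℝ}
    (hX : ∀ k, Integrable (X k) P) (hc : ∀ k, ∫ ω, X k ω ∂P ≤ c) (hK : ∀ k ω, K ≤ X k ω)
    (hlim : ∀ᵐ ω ∂P, Tendsto (fun k => X k ω) atTop (𝓝 (Z ω))) :
    Integrable Z P ∧ ∫ ω, Z ω ∂P ≤ c := by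
  have hZm : AEStronglyMeasurable Z P :=
    aestronglyMeasurable_of_tendsto_ae atTop (fun k => (hX k).aestronglyMeasurable) hlim
  have hZ0 : 0 ≤ᵐ[P] fun ω => Z ω - K := by
    filter_upwards [hlim] with ω hω
    exact sub_nonneg.2 (ge_of_tendsto' hω fun k => hK k ω)
  have hKc : 0 ≤ c - K := by
    have h := integral_mono (integrable_const K) (hX 0) (hK 0)
    simp only [integral_const, probReal_univ, one_smul] at h
    linarith [hc 0]
  have hlint : ∫⁻ ω, ENNReal.ofReal (Z ω - K) ∂P ≤ ENNReal.ofReal (c - K) := by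
    calc ∫⁻ ω, ENNReal.ofReal (Z ω - K) ∂P
        = ∫⁻ ω, liminf (fun k => ENNReal.ofReal (X k ω - K)) atTop ∂P := by
          refine lintegral_congr_ae ?_
          filter_upwards [hlim] with ω hω
          exact ((ENNReal.continuous_ofReal.tendsto _).comp
            (hω.sub_const K)).liminf_eq.symm
      _ ≤ liminf (fun k => ∫⁻ ω, ENNReal.ofReal (X k ω - K) ∂P) atTop :=
          lintegral_liminf_le' fun k =>
            ((hX k).aestronglyMeasurable.aemeasurable.sub_const K).ennreal_ofReal
      _ ≤ ENNReal.ofReal (c - K) := by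
          refine liminf_le_of_le (by isBoundedDefault) fun b hb => ?_
          obtain ⟨k, hk⟩ := hb.exists
          refine hk.trans ?_
          rw [← ofReal_integral_eq_lintegral_ofReal (f := fun ω => X k ω - K)
            ((hX k).sub (integrable_const K)) (ae_of_all _ fun ω => sub_nonneg.2 (hK k ω))]
          refine ENNReal.ofReal_le_ofReal ?_
          rw [integral_sub (hX k) (integrable_const K)]
          simp only [integral_const, probReal_univ, one_smul]
          linarith [hc k]
  have hint : Integrable (fun ω => Z ω - K) P := by
    refine ⟨hZm.sub aestronglyMeasurable_const, ?_⟩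
    rw [hasFiniteIntegral_iff_ofReal hZ0]
    exact hlint.trans_lt ENNReal.ofReal_lt_top
  have hZi : Integrable Z P := by
    have := hint.add (integrable_const K)
    refine this.congr (ae_of_all _ fun ω => ?_)
    simp
  refine ⟨hZi, ?_⟩
  have h1 : ∫ ω, (Z ω - K) ∂P ≤ c - K := by
    rw [integral_eq_lintegral_of_nonneg_ae hZ0 hint.aestronglyMeasurable]
    exact ENNReal.toReal_le_of_le_ofReal hKc hlint
  rw [integral_sub hZi (integrable_const K)] at h1
  simp only [integral_const, probReal_univ, one_smul] at h1
  linarith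

/-! ### Local martingales -/

/-- The stopped processes of a localising sequence. At time t each one is 0 or a value of M at an
earlier time, so any bound on M over [0, t] serves the whole sequence at once. -/
theorem Locally.exists_martingale_approx {Ω : Type*} {mΩ : MeasurableSpace Ω} {P : Measure Ω}
    {ℱ : Filtration ℝ≥0 mΩ} {M : ℝ≥0 → Ω → ℝ}
    (h : Locally (fun M => Martingale M ℱ P) ℱ M P) :
    ∃ N : ℕ → ℝ≥0 → Ω → ℝ, (∀ k, Martingale (N k) ℱ P) ∧
      (∀ k t ω, N k t ω = 0 ∨ ∃ r ≤ t, N k t ω = M r ω) ∧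
      ∀ᵐ ω ∂P, ∀ t, ∀ᶠ k in atTop, N k t ω = M t ω := by
  obtain ⟨τ, hτ, hN⟩ := h
  refine ⟨_, hN, fun k t ω => ?_, ?_⟩
  · by_cases hω : ω ∈ {ω | ⊥ < τ k ω}
    · refine Or.inr ⟨(min (t : WithTop ℝ≥0) (τ k ω)).untopA, ?_, ?_⟩
      · exact WithTop.untopA_le (min_le_left _ _)
      · simp only [stoppedProcess, Set.indicator_of_mem hω]
    · exact Or.inl (by simp only [stoppedProcess, Set.indicator_of_notMem hω])
  · filter_upwards [hτ.tendsto_top] with ω hω t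
    have ht : ∀ᶠ k in atTop, (t : WithTop ℝ≥0) < τ k ω :=
      hω.eventually_const_lt (WithTop.coe_lt_top t)
    filter_upwards [ht] with k hk
    rw [stoppedProcess_eq_of_le hk.le, Set.indicator_of_mem]
    exact lt_of_le_of_lt bot_le hk

theorem integrable_intervalIntegral {Ω : Type*} {mΩ : MeasurableSpace Ω} {P : Measure Ω}
    [SFinite P] {F : ℝ → Ω → ℝ} {a b : ℝ}
    (h : Integrable (Function.uncurry F) ((volume.restrict (Set.uIoc a b)).prod P)) :
    Integrable (fun ω => ∫ s in a..b, F s ω) P := by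
  simp only [intervalIntegral.intervalIntegral_eq_integral_uIoc]
  exact h.integral_prod_right.smul (if a ≤ b then (1 : ℝ) else -1)

namespace IsJumpDiffusion

variable {Ω : Type*} {mΩ : MeasurableSpace Ω} {𝒢 : JumpDiffusionOperator} {P : Measure Ω}
  {ℱ : Filtration ℝ≥0 mΩ} {Y : ℝ≥0 → Ω → ℝ} {y : ℝ}

/-! ### Existence of moments -/

section Moments

variable [IsProbabilityMeasure P]

theorem integrable_of_bounded (hY : IsJumpDiffusion 𝒢 P ℱ Y y) {f : ℝ → ℝ} (hf : Measurable f)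
    {B : ℝ} (hB : ∀ x, |f x| ≤ B) (t : ℝ≥0) : Integrable (fun ω => f (Y t ω)) P :=
  Integrable.of_bound (hf.comp (hY.measurable t)).aestronglyMeasurable B
    (ae_of_all _ fun _ => hB _)

theorem integrable_prod_of_bounded (hY : IsJumpDiffusion 𝒢 P ℱ Y y) {f : ℝ → ℝ}
    (hf : Measurable f) {B : ℝ} (hB : ∀ x, |f x| ≤ B) (a b : ℝ) :
    Integrable (Function.uncurry fun (s : ℝ) ω => f (Y s.toNNReal ω))
      ((volume.restrict (Set.uIoc a b)).prod P) := by
  have : IsFiniteMeasure (volume.restrict (Set.uIoc a b)) := ⟨by simp [Set.uIoc]⟩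
  exact Integrable.of_bound (hf.comp hY.measurable_uncurry).aestronglyMeasurable B
    (ae_of_all _ fun _ => hB _)

/-- No moment of `Y` is known yet, so 𝒢 f(Y) has no integrable majorant. The upper bound on 𝒢 f and
the bounds on f still keep the localised martingales bounded below, and Fatou's lemma gives the
inequality in the needed direction. -/
theorem integral_le_add_integral (hY : IsJumpDiffusion 𝒢 P ℱ Y y) (h𝒢 : 𝒢.IsPolynomial)
    {f : ℝ → ℝ} {C : ℝ} {d : ℕ} (hf : DerivGrowth f C d) (hf0 : ∀ x, 0 ≤ f x) {B : ℝ}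
    (hB : ∀ x, f x ≤ B) {c : ℝ} (hc : 0 ≤ c) (hfc : ∀ x, 𝒢.apply f x ≤ c * f x) (t : ℝ≥0) :
    ∫ ω, f (Y t ω) ∂P ≤ f y + c * ∫ s in (0 : ℝ)..t, ∫ ω, f (Y s.toNNReal ω) ∂P := by
  have hBabs : ∀ x, |f x| ≤ B := fun x => by rw [abs_of_nonneg (hf0 x)]; exact hB x
  have hB0 : 0 ≤ B := (hf0 0).trans (hB 0)
  have hfm : Measurable f := hf.contDiff.continuous.measurable
  obtain ⟨K, N, hK, hG⟩ := h𝒢.exists_abs_apply_le d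
  have hGi : ∀ a b ω, IntervalIntegrable (fun s : ℝ => 𝒢.apply f (Y s.toNNReal ω)) volume a b :=
    hY.intervalIntegrable (h𝒢.measurable_apply hf) (hG f C hf)
  have hfi : ∀ a b ω, IntervalIntegrable (fun s : ℝ => f (Y s.toNNReal ω)) volume a b :=
    hY.intervalIntegrable hfm (K := B) (N := 0) (by simpa using hBabs)
  obtain ⟨N, hN, hN0, hNM⟩ := Locally.exists_martingale_approx
    (hY.local_martingale f hf.contDiff ⟨B, hBabs⟩)
  have hint : ∀ (r : ℝ≥0) ω, ∫ s in (0 : ℝ)..r, 𝒢.apply f (Y s.toNNReal ω)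
      ≤ c * ∫ s in (0 : ℝ)..r, f (Y s.toNNReal ω) := fun r ω => by
    rw [← intervalIntegral.integral_const_mul]
    exact intervalIntegral.integral_mono_on r.2 (hGi _ _ _) ((hfi _ _ _).const_mul c)
      fun s _ => hfc _
  have hint' : ∀ (r : ℝ≥0) ω, ∫ s in (0 : ℝ)..r, f (Y s.toNNReal ω) ≤ B * r := fun r ω => by
    have := intervalIntegral.integral_mono_on r.2 (hfi 0 r ω)
      (intervalIntegrable_const (c := B)) fun s _ => hB _
    refine this.trans (le_of_eq ?_)
    simp [mul_comm]
  have hlow : ∀ k ω, -(B + c * (B * t)) ≤ N k t ω := fun k ω => by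
    rcases hN0 k t ω with h | ⟨r, hr, h⟩
    · rw [h, neg_nonpos]; positivity
    · rw [h]
      have h1 := hint r ω
      have h2 : c * ∫ s in (0 : ℝ)..r, f (Y s.toNNReal ω) ≤ c * (B * t) := by
        refine mul_le_mul_of_nonneg_left ((hint' r ω).trans ?_) hc
        exact mul_le_mul_of_nonneg_left (NNReal.coe_le_coe.2 hr) hB0
      linarith [hf0 (Y r ω), hB y]
  have hmean : ∀ k, ∫ ω, N k t ω ∂P ≤ 0 := fun k => by
    have h1 := (hN k).setIntegral_eq (zero_le : (0 : ℝ≥0) ≤ t) MeasurableSet.univ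
    rw [setIntegral_univ, setIntegral_univ] at h1
    rw [← h1]
    refine le_of_eq (integral_eq_zero_of_ae ?_)
    filter_upwards [hY.initial] with ω hω
    rcases hN0 k 0 ω with h | ⟨r, hr, h⟩
    · exact h
    · obtain rfl : r = 0 := le_antisymm hr zero_le
      rw [h]
      simp [hω]
  obtain ⟨hMi, hM0⟩ := integrable_and_integral_le_of_tendsto (fun k => (hN k).integrable t) hmean
    hlow (hNM.mono fun ω hω => tendsto_nhds_of_eventually_eq (hω t))
  have hprod := hY.integrable_prod_of_bounded hfm hBabs 0 t
  have hprodi : Integrable (fun ω => ∫ s in (0 : ℝ)..t, f (Y s.toNNReal ω)) P :=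
    integrable_intervalIntegral hprod
  rw [intervalIntegral_integral_swap hprod]
  calc ∫ ω, f (Y t ω) ∂P
      ≤ ∫ ω, ((f (Y t ω) - f y - ∫ s in (0 : ℝ)..t, 𝒢.apply f (Y s.toNNReal ω))
          + (f y + c * ∫ s in (0 : ℝ)..t, f (Y s.toNNReal ω))) ∂P := by
        refine integral_mono (hY.integrable_of_bounded hfm hBabs t)
          (hMi.add ((integrable_const _).add (hprodi.const_mul c))) fun ω => ?_
        have := hint t ω
        simp only
        linarith
    _ ≤ _ := by
        have h2 : Integrable (fun ω => f y + c * ∫ s in (0 : ℝ)..t, f (Y s.toNNReal ω)) P :=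
          (integrable_const _).add (hprodi.const_mul c)
        rw [integral_add hMi h2, integral_add (integrable_const _) (hprodi.const_mul c), integral_const_mul]
        simp only [integral_const, probReal_univ, one_smul]
        linarith

end Moments

end IsJumpDiffusion

/-- A crude form of Gronwall's inequality for bounded functions. -/
theorem le_two_mul_exp_of_le_add_integral {u : ℝ≥0 → ℝ} {a c B : ℝ} (hc : 0 < c)
    (hB : ∀ t, u t ≤ B) (hB0 : 0 ≤ B)
    (hi : ∀ t : ℝ≥0, IntervalIntegrable (fun s : ℝ => u s.toNNReal) volume 0 t)
    (ha : 0 ≤ a) (h : ∀ t : ℝ≥0, u t ≤ a + c * ∫ s in (0 : ℝ)..t, u s.toNNReal) (t : ℝ≥0) :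
    u t ≤ 2 * a * Real.exp (2 * c * t) := by
  -- The rate is 2c rather than c so that the integral term returns at most w / 2; then w ≤ a + w /
  -- 2. The bound B makes w finite.
  set w := ⨆ t : ℝ≥0, Real.exp (-(2 * c * t)) * u t with hw
  have hbdd : BddAbove (Set.range fun t : ℝ≥0 => Real.exp (-(2 * c * t)) * u t) := by
    refine ⟨B, ?_⟩
    rintro _ ⟨t, rfl⟩
    have : Real.exp (-(2 * c * t)) ≤ 1 := Real.exp_le_one_iff.2 (by
      have := t.2; rw [neg_nonpos]; positivity)
    calc Real.exp (-(2 * c * t)) * u t ≤ Real.exp (-(2 * c * t)) * B := by gcongr; exact hB t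
      _ ≤ 1 * B := by gcongr
      _ = B := one_mul B
  have hle : ∀ t : ℝ≥0, u t ≤ w * Real.exp (2 * c * t) := fun t => by
    have h1 : Real.exp (-(2 * c * t)) * u t ≤ w := le_ciSup hbdd t
    rw [Real.exp_neg, inv_mul_le_iff₀ (Real.exp_pos _)] at h1
    linarith
  have hint : ∀ t : ℝ≥0, ∫ s in (0 : ℝ)..t, w * Real.exp (2 * c * s)
      = w * ((Real.exp (2 * c * t) - 1) / (2 * c)) := fun t => by
    rw [intervalIntegral.integral_const_mul]
    congr 1
    rw [intervalIntegral.integral_comp_mul_left (fun x => Real.exp x) (by positivity : 2 * c ≠ 0), integral_exp]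
    simp
    ring
  have hw2 : w ≤ 2 * a := by
    by_contra! hlt
    have hw0 : 0 < w := by linarith
    have : w ≤ a + w / 2 := ciSup_le fun t => by
      have h1 : ∫ s in (0 : ℝ)..t, u s.toNNReal ≤ ∫ s in (0 : ℝ)..t, w * Real.exp (2 * c * s) := by
        refine intervalIntegral.integral_mono_on t.2 (hi t)
          (Continuous.intervalIntegrable (by fun_prop) _ _) fun s hs => ?_
        have := hle s.toNNReal
        rwa [Real.coe_toNNReal s hs.1] at this
      rw [hint] at h1
      have h2 : u t ≤ a + w * Real.exp (2 * c * t) / 2 := by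
        calc u t ≤ a + c * (w * ((Real.exp (2 * c * t) - 1) / (2 * c))) :=
              (h t).trans (by gcongr)
          _ = a + w * Real.exp (2 * c * t) / 2 - w / 2 := by field_simp; ring
          _ ≤ _ := by linarith
      rw [Real.exp_neg, inv_mul_le_iff₀ (Real.exp_pos _)]
      have h3 : 1 ≤ Real.exp (2 * c * t) := Real.one_le_exp (by
        have := t.2; positivity)
      nlinarith
    linarith
  refine (hle t).trans ?_
  gcongr

namespace IsJumpDiffusion

variable {Ω : Type*} {mΩ : MeasurableSpace Ω} {𝒢 : JumpDiffusionOperator} {P : Measure Ω}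
  {ℱ : Filtration ℝ≥0 mΩ} {Y : ℝ≥0 → Ω → ℝ} {y : ℝ} [IsProbabilityMeasure P]

open Polynomial in
-- A Lyapunov argument: 𝒢 maps (1 + x²)^k to a polynomial of degree at most 2k, hence bounded by a
-- multiple of (1 + x²)^k. The concave truncations inherit this with the same constant, so the
-- Gronwall bound does not depend on the truncation level.
theorem exists_moment_le (hY : IsJumpDiffusion 𝒢 P ℱ Y y) (h𝒢 : 𝒢.IsPolynomial) (k : ℕ) :
    ∃ a c, 0 ≤ a ∧ 0 ≤ c ∧ ∀ t : ℝ≥0, Integrable (fun ω => (1 + Y t ω ^ 2) ^ k) P ∧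
      ∫ ω, (1 + Y t ω ^ 2) ^ k ∂P ≤ a * Real.exp (c * t) := by
  set p : ℝ[X] := (1 + X ^ 2) ^ k with hp
  have hpe : ∀ x, p.eval x = (1 + x ^ 2) ^ k := fun x => by simp [hp]
  have hp1 : ∀ x, 1 ≤ p.eval x := fun x => by
    rw [hpe]; exact one_le_pow₀ (one_le_one_add_sq x)
  have hdeg : p ∈ degreeLE ℝ ((2 * k : ℕ) : WithBot ℕ) := by
    rw [mem_degreeLE, hp]
    refine (degree_pow_le _ _).trans ?_
    have : (1 + X ^ 2 : ℝ[X]).degree ≤ (2 : ℕ) := by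
      compute_degree
      exact le_rfl
    refine (nsmul_le_nsmul_right this k).trans (le_of_eq ?_)
    rw [nsmul_eq_mul, mul_comm]
    norm_cast
  obtain ⟨q, hq, hqx⟩ := h𝒢.mapsTo_degreeLE (2 * k) p hdeg
  obtain ⟨c₀, hc₀, hqc⟩ := q.exists_abs_eval_le (k := k)
    (natDegree_le_of_degree_le (mem_degreeLE.1 hq))
  -- Adding 1 makes the rate strictly positive, as the Gronwall step requires.
  set c := c₀ + 1 with hcdef
  have hc : 0 < c := by linarith
  have happ : ∀ m : ℝ, 0 < m → ∀ x, 𝒢.apply (concaveTrunc m p) x ≤ c * concaveTrunc m p x := by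
    intro m hm x
    have hx := hp1 x
    refine (h𝒢.apply_concaveTrunc_le hm hp1 x).trans ?_
    have h1 : 𝒢.apply (fun u => p.eval u) x ≤ c * p.eval x := by
      rw [hqx]
      refine ((le_abs_self _).trans (hqc x)).trans ?_
      rw [hpe]
      gcongr
      linarith
    calc _ ≤ m ^ 2 / (m + p.eval x) ^ 2 * (c * p.eval x) := by gcongr
      _ ≤ c * concaveTrunc m p x := by
          have h0 : m + p.eval x ≠ 0 := by positivity
          -- This is v φ'(v) ≤ φ(v), with the difference written out.
          have : c * concaveTrunc m p x - m ^ 2 / (m + p.eval x) ^ 2 * (c * p.eval x)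
              = c * m * p.eval x ^ 2 / (m + p.eval x) ^ 2 := by
            rw [concaveTrunc]
            field_simp
            ring
          have h2 : 0 ≤ c * m * p.eval x ^ 2 / (m + p.eval x) ^ 2 := by positivity
          linarith
  refine ⟨2 * p.eval y, 2 * c, by have := hp1 y; positivity, by positivity, fun t => ?_⟩
  have hbound : ∀ j : ℕ, ∫ ω, concaveTrunc ((j : ℝ) + 1) p (Y t ω) ∂P
      ≤ 2 * p.eval y * Real.exp (2 * c * t) := fun j => by
    have hm : (0 : ℝ) < j + 1 := by positivity
    obtain ⟨C, d, hf⟩ := exists_derivGrowth_concaveTrunc hm hp1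
    have hfm : Measurable (concaveTrunc ((j : ℝ) + 1) p) := hf.contDiff.continuous.measurable
    have habs : ∀ x, |concaveTrunc ((j : ℝ) + 1) p x| ≤ (j : ℝ) + 1 := fun x => by
      rw [abs_of_nonneg (concaveTrunc_nonneg hm hp1 x)]
      exact concaveTrunc_le hm hp1 x
    have h1 := le_two_mul_exp_of_le_add_integral
      (u := fun t => ∫ ω, concaveTrunc ((j : ℝ) + 1) p (Y t ω) ∂P) hc (B := (j : ℝ) + 1)
      (fun t => ?_) hm.le (fun t => ?_) (concaveTrunc_nonneg hm hp1 y)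
      (fun t => hY.integral_le_add_integral h𝒢 hf (concaveTrunc_nonneg hm hp1)
        (concaveTrunc_le hm hp1) hc.le (happ _ hm) t) t
    · refine h1.trans ?_
      gcongr
      exact concaveTrunc_le_eval hm hp1 y
    · have := integral_mono (hY.integrable_of_bounded hfm habs t)
        (integrable_const ((j : ℝ) + 1)) fun ω => concaveTrunc_le hm hp1 _
      simpa using this
    · rw [intervalIntegrable_iff]
      exact (hY.integrable_prod_of_bounded hfm habs 0 t).integral_prod_left
  have := integrable_and_integral_le_of_tendsto (K := 0)
    (fun j : ℕ => hY.integrable_of_bounded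
      (f := concaveTrunc ((j : ℝ) + 1) p) ?_ (B := (j : ℝ) + 1) ?_ t) hbound
    (fun j ω => concaveTrunc_nonneg (by positivity) hp1 _)
    (ae_of_all _ fun ω => tendsto_concaveTrunc (Y t ω) hp1)
  · simpa only [hpe] using this
  · obtain ⟨C, d, hf⟩ := exists_derivGrowth_concaveTrunc (m := (j : ℝ) + 1) (by positivity) hp1
    exact hf.contDiff.continuous.measurable
  · intro x
    rw [abs_of_nonneg (concaveTrunc_nonneg (by positivity) hp1 x)]
    exact concaveTrunc_le (by positivity) hp1 x

end IsJumpDiffusion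

/-! ### Dynkin's formula for polynomials -/

namespace IsJumpDiffusion

variable {Ω : Type*} {mΩ : MeasurableSpace Ω} {𝒢 : JumpDiffusionOperator} {P : Measure Ω}
  {ℱ : Filtration ℝ≥0 mΩ} {Y : ℝ≥0 → Ω → ℝ} {y : ℝ}

/-- The process `f(Y(t)) - f(y) - ∫₀ᵗ 𝒢 f(Y(s)) ds`. -/
def compensated (𝒢 : JumpDiffusionOperator) (Y : ℝ≥0 → Ω → ℝ) (y : ℝ) (f : ℝ → ℝ) (t : ℝ≥0)
    (ω : Ω) : ℝ :=
  f (Y t ω) - f y - ∫ s in (0 : ℝ)..t, 𝒢.apply f (Y s.toNNReal ω)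

/-- The integral runs to t although the left side is taken at r. This covers every stopped time up
to t with one dominating integral. -/
theorem abs_compensated_le (hY : IsJumpDiffusion 𝒢 P ℱ Y y) {f : ℝ → ℝ} {K : ℝ} {N : ℕ}
    (hK : ∀ x, |𝒢.apply f x| ≤ K * (1 + x ^ 2) ^ N) {r t : ℝ≥0} (hrt : r ≤ t) (ω : Ω) :
    |compensated 𝒢 Y y f r ω| ≤ |f (Y r ω)| + |f y|
      + ∫ s in (0 : ℝ)..t, K * (1 + Y s.toNNReal ω ^ 2) ^ N := by
  have hK0 : 0 ≤ K := by simpa using (abs_nonneg _).trans (hK 0)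
  have hi : ∀ a b, IntervalIntegrable (fun s : ℝ => K * (1 + Y s.toNNReal ω ^ 2) ^ N)
      volume a b := fun a b =>
    hY.intervalIntegrable (g := fun x => K * (1 + x ^ 2) ^ N) (by fun_prop) (K := K) (N := N)
      (fun x => (abs_of_nonneg (by positivity)).le) a b ω
  have h1 : |∫ s in (0 : ℝ)..r, 𝒢.apply f (Y s.toNNReal ω)|
      ≤ ∫ s in (0 : ℝ)..r, K * (1 + Y s.toNNReal ω ^ 2) ^ N := by
    rw [← Real.norm_eq_abs]
    exact intervalIntegral.norm_integral_le_of_norm_le r.2 (ae_of_all _ fun s _ => hK _) (hi _ _)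
  have h2 : ∫ s in (0 : ℝ)..r, K * (1 + Y s.toNNReal ω ^ 2) ^ N
      ≤ ∫ s in (0 : ℝ)..t, K * (1 + Y s.toNNReal ω ^ 2) ^ N :=
    intervalIntegral.integral_mono_interval le_rfl r.2 (NNReal.coe_le_coe.2 hrt)
      (ae_of_all _ fun s => by positivity) (hi _ _)
  have h3 := abs_sub (f (Y r ω) - f y) (∫ s in (0 : ℝ)..r, 𝒢.apply f (Y s.toNNReal ω))
  have h4 := abs_sub (f (Y r ω)) (f y)
  rw [compensated]
  linarith

variable [IsProbabilityMeasure P]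

theorem integrable_of_growth (hY : IsJumpDiffusion 𝒢 P ℱ Y y) (h𝒢 : 𝒢.IsPolynomial) {g : ℝ → ℝ}
    (hg : Measurable g) {K : ℝ} {N : ℕ} (hK : ∀ x, |g x| ≤ K * (1 + x ^ 2) ^ N) (t : ℝ≥0) :
    Integrable (fun ω => g (Y t ω)) P := by
  obtain ⟨a, c, -, -, h⟩ := hY.exists_moment_le h𝒢 N
  exact ((h t).1.const_mul K).mono' (hg.comp (hY.measurable t)).aestronglyMeasurable
    (ae_of_all _ fun ω => hK _)

theorem integrable_eval (hY : IsJumpDiffusion 𝒢 P ℱ Y y) (h𝒢 : 𝒢.IsPolynomial)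
    (p : Polynomial ℝ) (t : ℝ≥0) : Integrable (fun ω => p.eval (Y t ω)) P := by
  obtain ⟨C, -, h⟩ := p.exists_abs_eval_le'
  exact hY.integrable_of_growth h𝒢 p.continuous.measurable h t

/-- The moment bound is locally bounded in time, which gives joint integrability and so permits the
exchange of time integrals and expectations. -/
theorem integrable_prod_of_growth (hY : IsJumpDiffusion 𝒢 P ℱ Y y) (h𝒢 : 𝒢.IsPolynomial)
    {g : ℝ → ℝ} (hg : Measurable g) {K : ℝ} {N : ℕ} (hK : ∀ x, |g x| ≤ K * (1 + x ^ 2) ^ N)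
    (a b : ℝ) :
    Integrable (Function.uncurry fun (s : ℝ) ω => g (Y s.toNNReal ω))
      ((volume.restrict (Set.uIoc a b)).prod P) := by
  have hfin : IsFiniteMeasure (volume.restrict (Set.uIoc a b)) := ⟨by simp [Set.uIoc]⟩
  obtain ⟨A, c, hA, hc, h⟩ := hY.exists_moment_le h𝒢 N
  have hm : Measurable fun q : ℝ × Ω => (1 + Y q.1.toNNReal q.2 ^ 2) ^ N :=
    ((hY.measurable_uncurry.pow_const 2).const_add 1).pow_const N
  have hw : Integrable (fun q : ℝ × Ω => (1 + Y q.1.toNNReal q.2 ^ 2) ^ N)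
      ((volume.restrict (Set.uIoc a b)).prod P) := by
    refine (integrable_prod_iff hm.aestronglyMeasurable).2
      ⟨ae_of_all _ fun s => (h s.toNNReal).1, ?_⟩
    refine Integrable.of_bound hm.norm.stronglyMeasurable.integral_prod_right'.aestronglyMeasurable
      (A * Real.exp (c * (max a b).toNNReal)) ?_
    refine (ae_restrict_iff' measurableSet_uIoc).2 (ae_of_all _ fun s hs => ?_)
    rw [Real.norm_of_nonneg (integral_nonneg fun _ => norm_nonneg _)]
    have e : ∀ ω, ‖(1 + Y s.toNNReal ω ^ 2) ^ N‖ = (1 + Y s.toNNReal ω ^ 2) ^ N := fun ω =>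
      Real.norm_of_nonneg (by positivity)
    simp only [e]
    refine (h s.toNNReal).2.trans ?_
    gcongr
    exact hs.2
  exact (hw.const_mul K).mono' (hg.comp hY.measurable_uncurry).aestronglyMeasurable
    (ae_of_all _ fun q => hK _)

theorem integrable_integral_growth (hY : IsJumpDiffusion 𝒢 P ℱ Y y) (h𝒢 : 𝒢.IsPolynomial)
    {K : ℝ} (hK : 0 ≤ K) (N : ℕ) (a b : ℝ) :
    Integrable (fun ω => ∫ s in a..b, K * (1 + Y s.toNNReal ω ^ 2) ^ N) P :=
  integrable_intervalIntegral (hY.integrable_prod_of_growth h𝒢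
    (g := fun x => K * (1 + x ^ 2) ^ N) (by fun_prop) (K := K) (N := N)
    (fun x => (abs_of_nonneg (by positivity)).le) a b)

theorem aestronglyMeasurable_compensated (hY : IsJumpDiffusion 𝒢 P ℱ Y y) (h𝒢 : 𝒢.IsPolynomial)
    {f : ℝ → ℝ} {C : ℝ} {d : ℕ} (hf : DerivGrowth f C d) (t : ℝ≥0) :
    AEStronglyMeasurable (compensated 𝒢 Y y f t) P := by
  obtain ⟨K, N, hK, hG⟩ := h𝒢.exists_abs_apply_le d
  have h1 := integrable_intervalIntegral (hY.integrable_prod_of_growth h𝒢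
    (h𝒢.measurable_apply hf) (hG f C hf) 0 t)
  exact ((hf.contDiff.continuous.measurable.comp
    (hY.measurable t)).sub_const (f y)).aestronglyMeasurable.sub h1.aestronglyMeasurable

/-- The moments now dominate the localised martingales, so their limit keeps the martingale property
on each event of the past. -/
theorem setIntegral_compensated_of_bounded (hY : IsJumpDiffusion 𝒢 P ℱ Y y)
    (h𝒢 : 𝒢.IsPolynomial) {f : ℝ → ℝ} {C : ℝ} {d : ℕ} (hf : DerivGrowth f C d) {B : ℝ}
    (hB : ∀ x, |f x| ≤ B) {s t : ℝ≥0} (hst : s ≤ t) {A : Set Ω} (hA : MeasurableSet[ℱ s] A) :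
    ∫ ω in A, compensated 𝒢 Y y f s ω ∂P = ∫ ω in A, compensated 𝒢 Y y f t ω ∂P := by
  obtain ⟨K, N, hK, hG⟩ := h𝒢.exists_abs_apply_le d
  have hCK : 0 ≤ C * K := mul_nonneg hf.nonneg hK
  obtain ⟨M, hM, hM0, hMlim⟩ := Locally.exists_martingale_approx
    (hY.local_martingale f hf.contDiff ⟨B, hB⟩)
  have hB0 : 0 ≤ B := (abs_nonneg _).trans (hB 0)
  have hlim : ∀ u ≤ t, Tendsto (fun k => ∫ ω in A, M k u ω ∂P) atTop
      (𝓝 (∫ ω in A, compensated 𝒢 Y y f u ω ∂P)) := fun u hu => by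
    refine tendsto_integral_of_dominated_convergence
      (fun ω => B + B + ∫ s in (0 : ℝ)..t, C * K * (1 + Y s.toNNReal ω ^ 2) ^ N)
      (fun k => ((hM k).integrable u).aestronglyMeasurable.restrict)
      ((integrable_const _).add (hY.integrable_integral_growth h𝒢 hCK N 0 t)).restrict
      (fun k => ae_of_all _ fun ω => ?_)
      (ae_restrict_of_ae (hMlim.mono fun ω hω => tendsto_nhds_of_eventually_eq (hω u)))
    rcases hM0 k u ω with h | ⟨r, hr, h⟩
    · rw [h, norm_zero]
      have : 0 ≤ ∫ s in (0 : ℝ)..t, C * K * (1 + Y s.toNNReal ω ^ 2) ^ N :=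
        intervalIntegral.integral_nonneg t.2 fun s _ => by positivity
      positivity
    · rw [h]
      have := hY.abs_compensated_le (hG f C hf) (hr.trans hu) ω
      exact this.trans (by linarith [hB (Y r ω), hB y])
  refine tendsto_nhds_unique (hlim s hst) ((hlim t le_rfl).congr fun k => ?_)
  exact ((hM k).setIntegral_eq hst hA).symm

theorem setIntegral_compensated_eval (hY : IsJumpDiffusion 𝒢 P ℱ Y y)
    (h𝒢 : 𝒢.IsPolynomial) (p : Polynomial ℝ) {s t : ℝ≥0} (hst : s ≤ t) {A : Set Ω}
    (hA : MeasurableSet[ℱ s] A) :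
    ∫ ω in A, compensated 𝒢 Y y (fun u => p.eval u) s ω ∂P
      = ∫ ω in A, compensated 𝒢 Y y (fun u => p.eval u) t ω ∂P := by
  obtain ⟨C, d, hf⟩ := exists_derivGrowth_sinTrunc p
  have hf' : ∀ j : ℕ, DerivGrowth (sinTrunc ((j : ℝ) + 1) p) C d := fun j =>
    hf _ (by linarith [(Nat.cast_nonneg j : (0 : ℝ) ≤ j)])
  obtain ⟨K, N, hK, hG⟩ := h𝒢.exists_abs_apply_le d
  obtain ⟨C₀, hC₀, hp⟩ := p.exists_abs_eval_le'
  have hCK : 0 ≤ C * K := mul_nonneg (hf' 0).nonneg hK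
  have happ : ∀ x, Tendsto (fun j : ℕ => 𝒢.apply (sinTrunc ((j : ℝ) + 1) p) x) atTop
      (𝓝 (𝒢.apply (fun u => p.eval u) x)) :=
    h𝒢.tendsto_apply hf' (tendsto_sinTrunc p) (tendsto_deriv_sinTrunc p)
      (tendsto_deriv_deriv_sinTrunc p)
  have hlim : ∀ u : ℝ≥0, Tendsto
      (fun j : ℕ => ∫ ω in A, compensated 𝒢 Y y (sinTrunc ((j : ℝ) + 1) p) u ω ∂P) atTop
      (𝓝 (∫ ω in A, compensated 𝒢 Y y (fun u => p.eval u) u ω ∂P)) := fun u => by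
    refine tendsto_integral_of_dominated_convergence
      (fun ω => C₀ * (1 + Y u ω ^ 2) ^ p.natDegree + C₀ * (1 + y ^ 2) ^ p.natDegree
        + ∫ s in (0 : ℝ)..u, C * K * (1 + Y s.toNNReal ω ^ 2) ^ N)
      (fun j => (hY.aestronglyMeasurable_compensated h𝒢 (hf' j) u).restrict)
      (((hY.integrable_of_growth h𝒢 (g := fun x => C₀ * (1 + x ^ 2) ^ p.natDegree) (by fun_prop)
        (fun x => (abs_of_nonneg (by positivity)).le) u).add (integrable_const _)).add
        (hY.integrable_integral_growth h𝒢 hCK N 0 u)).restrict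
      (fun j => ae_of_all _ fun ω => ?_) (ae_of_all _ fun ω => ?_)
    · have := hY.abs_compensated_le (hG _ C (hf' j)) (le_refl u) ω
      have hj : (0 : ℝ) < j + 1 := by positivity
      exact this.trans (add_le_add_left (add_le_add (abs_sinTrunc_le hj hC₀ hp _)
        (abs_sinTrunc_le hj hC₀ hp _)) _)
    · refine ((tendsto_sinTrunc p _).sub (tendsto_sinTrunc p _)).sub ?_
      refine intervalIntegral.tendsto_integral_filter_of_dominated_convergence
        (fun s => C * K * (1 + Y s.toNNReal ω ^ 2) ^ N)
        (Eventually.of_forall fun j => ?_)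
        (Eventually.of_forall fun j => ae_of_all _ fun s _ => hG _ C (hf' j) _) ?_
        (ae_of_all _ fun s _ => happ _)
      · exact ((h𝒢.measurable_apply (hf' j)).comp
          (hY.measurable_uncurry.comp measurable_prodMk_right)).aestronglyMeasurable
      · exact hY.intervalIntegrable (g := fun x => C * K * (1 + x ^ 2) ^ N) (by fun_prop)
          (fun x => (abs_of_nonneg (by positivity)).le) _ _ ω
  refine tendsto_nhds_unique (hlim s) ((hlim t).congr fun j => ?_)
  obtain ⟨B, hB⟩ := exists_abs_sinTrunc_le ((j : ℝ) + 1) p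
  exact (hY.setIntegral_compensated_of_bounded h𝒢 (hf' j) hB hst hA).symm

theorem integrable_prod_restrict_apply_eval (hY : IsJumpDiffusion 𝒢 P ℱ Y y)
    (h𝒢 : 𝒢.IsPolynomial) (p : Polynomial ℝ) (a b : ℝ) (A : Set Ω) :
    Integrable (Function.uncurry fun (r : ℝ) ω => 𝒢.apply (fun u => p.eval u) (Y r.toNNReal ω))
      ((volume.restrict (Set.uIoc a b)).prod (P.restrict A)) := by
  obtain ⟨C, d, hf⟩ := p.exists_derivGrowth
  obtain ⟨K, N, hK, hG⟩ := h𝒢.exists_abs_apply_le d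
  have h := (hY.integrable_prod_of_growth h𝒢 (h𝒢.measurable_apply hf) (hG _ C hf) a b).integrableOn
    (s := Set.univ ×ˢ A)
  rwa [IntegrableOn, ← Measure.prod_restrict, Measure.restrict_univ] at h

/-- Dynkin's formula for polynomials, on the events of the past. -/
theorem setIntegral_eval_eq (hY : IsJumpDiffusion 𝒢 P ℱ Y y)
    (h𝒢 : 𝒢.IsPolynomial) (p : Polynomial ℝ) {s t : ℝ≥0} (hst : s ≤ t) {A : Set Ω}
    (hA : MeasurableSet[ℱ s] A) :
    ∫ ω in A, p.eval (Y t ω) ∂P = ∫ ω in A, p.eval (Y s ω) ∂P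
      + ∫ r in (s : ℝ)..t, ∫ ω in A, 𝒢.apply (fun u => p.eval u) (Y r.toNNReal ω) ∂P := by
  have hprod := hY.integrable_prod_restrict_apply_eval h𝒢 p (A := A)
  have hexp : ∀ u : ℝ≥0, ∫ ω in A, compensated 𝒢 Y y (fun u => p.eval u) u ω ∂P
      = ∫ ω in A, p.eval (Y u ω) ∂P - ∫ _ in A, p.eval y ∂P
        - ∫ r in (0 : ℝ)..u, ∫ ω in A, 𝒢.apply (fun u => p.eval u) (Y r.toNNReal ω) ∂P :=
    fun u => by
    have h1 := (hY.integrable_eval h𝒢 p u).restrict (s := A)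
    have h2 : Integrable (fun ω => p.eval (Y u ω) - p.eval y) (P.restrict A) :=
      h1.sub (integrable_const _)
    rw [intervalIntegral_integral_swap (hprod 0 u), ← integral_sub h1 (integrable_const _),
      ← integral_sub h2 (integrable_intervalIntegral (hprod 0 u))]
    rfl
  have h := hY.setIntegral_compensated_eval h𝒢 p hst hA
  rw [hexp, hexp] at h
  have hi : ∀ a b : ℝ, IntervalIntegrable
      (fun r => ∫ ω in A, 𝒢.apply (fun u => p.eval u) (Y r.toNNReal ω) ∂P) volume a b :=
    fun a b => by
    rw [intervalIntegrable_iff]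
    exact (hprod a b).integral_prod_left
  have hadd := intervalIntegral.integral_add_adjacent_intervals (hi 0 s) (hi s t)
  linarith

end IsJumpDiffusion

/-! ### Linear integral equations and the matrix exponential -/

section LinearODE

open scoped Matrix.Norms.Operator in
theorem Matrix.hasDerivAt_exp_smul_mulVec {k : ℕ} (G : Matrix (Fin k) (Fin k) ℝ) (v : Fin k → ℝ)
    (t r : ℝ) :
    HasDerivAt (fun r : ℝ => NormedSpace.exp ((r - t) • G) *ᵥ v)
      (G *ᵥ (NormedSpace.exp ((r - t) • G) *ᵥ v)) r := by
  have h1 := (hasDerivAt_exp_smul_const' (𝕂 := ℝ) G (r - t)).comp_sub_const r t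
  let L : Matrix (Fin k) (Fin k) ℝ →ₗ[ℝ] (Fin k → ℝ) :=
    (Matrix.mulVecBilin ℝ ℝ).flip v
  have h2 := L.toContinuousLinearMap.hasFDerivAt.comp_hasDerivAt r h1
  rw [Matrix.mulVec_mulVec]
  exact h2

/-- Regularity is bootstrapped: the integral equation makes μ continuous from t on, continuity makes
the integral differentiable, and uniqueness for linear equations identifies the solution. -/
theorem eq_exp_mulVec_of_integral_eq {k : ℕ} (G : Matrix (Fin k) (Fin k) ℝ) (μ : ℝ → Fin k → ℝ)
    (t : ℝ) (hint : ∀ i a b, IntervalIntegrable (fun s => (G *ᵥ μ s) i) volume a b)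
    (h : ∀ r, t ≤ r → ∀ i, μ r i = μ t i + ∫ s in t..r, (G *ᵥ μ s) i) (r : ℝ) (hr : t ≤ r) :
    μ r = NormedSpace.exp ((r - t) • G) *ᵥ μ t := by
  have hcont : Continuous fun s => μ (max s t) := continuous_pi fun i => by
    have : (fun s => μ (max s t) i) = fun s => μ t i + ∫ s in t..(max s t), (G *ᵥ μ s) i :=
      funext fun s => h _ (le_max_right _ _) i
    rw [this]
    exact continuous_const.add ((intervalIntegral.continuous_primitive (hint i) t).comp
      (continuous_id.max continuous_const))
  have hcontG : ∀ i, Continuous fun s => (G *ᵥ μ (max s t)) i := fun i =>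
    (continuous_apply i).comp (Continuous.matrix_mulVec continuous_const hcont)
  -- Nothing is known of μ before t. Freezing the integrand there gives a two-sided derivative at t
  -- itself.
  let F : ℝ → Fin k → ℝ := fun r i => μ t i + ∫ s in t..r, (G *ᵥ μ (max s t)) i
  have hF : ∀ r, t ≤ r → F r = μ r := fun r hr => funext fun i => by
    rw [h r hr i]
    refine congrArg (μ t i + ·) (intervalIntegral.integral_congr fun s hs => ?_)
    rw [Set.uIcc_of_le hr] at hs
    simp only [max_eq_left hs.1]
  have hF' : ∀ r, t ≤ r → HasDerivAt F (G *ᵥ F r) r := fun s hs => by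
    rw [hasDerivAt_pi]
    intro i
    have := (intervalIntegral.integral_hasDerivAt_right ((hcontG i).intervalIntegrable t s)
      ((hcontG i).stronglyMeasurableAtFilter _ _) (hcontG i).continuousAt).const_add (μ t i)
    rw [hF s hs]
    simpa only [max_eq_left hs] using this
  have hE := Matrix.hasDerivAt_exp_smul_mulVec G (μ t) t
  let L := (Matrix.mulVecLin G).toContinuousLinearMap
  have huniq := ODE_solution_unique_of_mem_Icc_right (v := fun _ x => G *ᵥ x)
    (s := fun _ => Set.univ) (K := ‖L‖₊) (a := t) (b := r)
    (fun _ _ => L.lipschitz.lipschitzOnWith)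
    (fun s hs => (hF' s hs.1).continuousAt.continuousWithinAt)
    (fun s hs => (hF' s hs.1).hasDerivWithinAt) (fun _ _ => Set.mem_univ _)
    (fun s hs => (hE s).continuousAt.continuousWithinAt)
    (fun s hs => (hE s).hasDerivWithinAt) (fun _ _ => Set.mem_univ _)
    (by simp [F])
  rw [← hF r hr]
  exact huniq ⟨hr, le_rfl⟩

end LinearODE

theorem dotProduct_monomialVec_eq_eval (n : ℕ) (c : Fin (n + 1) → ℝ) (x : ℝ) :
    c ⬝ᵥ monomialVec n x
      = (∑ i : Fin (n + 1), Polynomial.C (c i) * Polynomial.X ^ (i : ℕ)).eval x := by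
  simp [dotProduct, monomialVec, Polynomial.eval_finsetSum]

theorem coeffVec_dotProduct_monomialVec {n : ℕ} {p : Polynomial ℝ}
    (hp : p ∈ Polynomial.degreeLE ℝ n) (x : ℝ) :
    coeffVec n p ⬝ᵥ monomialVec n x = p.eval x := by
  have hd : p.natDegree < n + 1 :=
    Nat.lt_succ_iff.mpr (Polynomial.natDegree_le_of_degree_le (Polynomial.mem_degreeLE.mp hp))
  rw [Polynomial.eval_eq_sum_range' hd,
    ← Fin.sum_univ_eq_sum_range (fun j => p.coeff j * x ^ j)]
  rfl

/-! ### Conditional moments -/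

namespace IsJumpDiffusion

variable {Ω : Type*} {mΩ : MeasurableSpace Ω} {𝒢 : JumpDiffusionOperator} {P : Measure Ω}
  {ℱ : Filtration ℝ≥0 mΩ} {Y : ℝ≥0 → Ω → ℝ} {y : ℝ} [IsProbabilityMeasure P]

theorem integrable_pow (hY : IsJumpDiffusion 𝒢 P ℱ Y y) (h𝒢 : 𝒢.IsPolynomial) (t : ℝ≥0) (i : ℕ) :
    Integrable (fun ω => Y t ω ^ i) P := by
  simpa using hY.integrable_eval h𝒢 (Polynomial.X ^ i) t

theorem integrable_dotProduct (hY : IsJumpDiffusion 𝒢 P ℱ Y y) (h𝒢 : 𝒢.IsPolynomial) (t : ℝ≥0)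
    {n : ℕ} (c : Fin (n + 1) → ℝ) : Integrable (fun ω => c ⬝ᵥ monomialVec n (Y t ω)) P := by
  simp only [dotProduct_monomialVec_eq_eval]
  exact hY.integrable_eval h𝒢 _ t

theorem setIntegral_dotProduct (hY : IsJumpDiffusion 𝒢 P ℱ Y y) (h𝒢 : 𝒢.IsPolynomial) (t : ℝ≥0)
    {n : ℕ} (c : Fin (n + 1) → ℝ) (A : Set Ω) :
    ∫ ω in A, c ⬝ᵥ monomialVec n (Y t ω) ∂P
      = c ⬝ᵥ fun i : Fin (n + 1) => ∫ ω in A, Y t ω ^ (i : ℕ) ∂P := by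
  simp only [dotProduct, monomialVec]
  rw [integral_finsetSum Finset.univ fun (i : Fin (n + 1)) _ => ((hY.integrable_pow h𝒢 t i).restrict.const_mul _)]
  simp only [integral_const_mul]

/-- Inserting 𝒢 H_n = G_n H_n into Dynkin's formula closes the system of moments over A. -/
theorem setIntegral_pow_eq_exp_mulVec (hY : IsJumpDiffusion 𝒢 P ℱ Y y) (h𝒢 : 𝒢.IsPolynomial)
    (n : ℕ) {t s : ℝ≥0} (hts : t ≤ s) {A : Set Ω} (hA : MeasurableSet[ℱ t] A) :
    (fun i : Fin (n + 1) => ∫ ω in A, Y s ω ^ (i : ℕ) ∂P)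
      = NormedSpace.exp (((s : ℝ) - t) • JumpDiffusionOperator.generatorMatrix h𝒢 n)
        *ᵥ fun i : Fin (n + 1) => ∫ ω in A, Y t ω ^ (i : ℕ) ∂P := by
  set G := JumpDiffusionOperator.generatorMatrix h𝒢 n with hG
  set μ : ℝ → Fin (n + 1) → ℝ := fun r i => ∫ ω in A, Y r.toNNReal ω ^ (i : ℕ) ∂P with hμ
  have hGμ : ∀ r i, (G *ᵥ μ r) i
      = ∫ ω in A, 𝒢.apply (fun u => (Polynomial.X ^ (i : ℕ) : Polynomial ℝ).eval u)
          (Y r.toNNReal ω) ∂P := fun r i => by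
    have h1 : ∀ x, 𝒢.apply (fun u => (Polynomial.X ^ (i : ℕ) : Polynomial ℝ).eval u) x
        = G i ⬝ᵥ monomialVec n x := fun x => by
      simp only [Polynomial.eval_pow, Polynomial.eval_X]
      exact congrFun (JumpDiffusionOperator.generatorMatrix_mulVec h𝒢 n x) i
    simp only [h1]
    exact (hY.setIntegral_dotProduct h𝒢 r.toNNReal (G i) A).symm
  have key := eq_exp_mulVec_of_integral_eq G μ t (fun i a b => ?_) (fun r hr i => ?_) s
    (NNReal.coe_le_coe.2 hts)
  · simpa only [hμ, Real.toNNReal_coe] using key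
  · simp only [hGμ, intervalIntegrable_iff]
    exact (hY.integrable_prod_restrict_apply_eval h𝒢 _ a b A).integral_prod_left
  · lift r to ℝ≥0 using t.2.trans hr
    have := hY.setIntegral_eval_eq h𝒢 (Polynomial.X ^ (i : ℕ)) (NNReal.coe_le_coe.1 hr) hA
    simp only [hGμ]
    simpa only [hμ, Real.toNNReal_coe, Polynomial.eval_pow, Polynomial.eval_X] using this

/-- The conditional moment formula. -/
theorem condExp_dotProduct_monomialVec (hY : IsJumpDiffusion 𝒢 P ℱ Y y) (h𝒢 : 𝒢.IsPolynomial)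
    {n : ℕ} (c : Fin (n + 1) → ℝ) {t s : ℝ≥0} (hts : t ≤ s) :
    P[fun ω => c ⬝ᵥ monomialVec n (Y s ω) | ℱ t] =ᵐ[P] fun ω =>
      c ⬝ᵥ (NormedSpace.exp (((s : ℝ) - t) • JumpDiffusionOperator.generatorMatrix h𝒢 n)
        *ᵥ monomialVec n (Y t ω)) := by
  set E := NormedSpace.exp (((s : ℝ) - t) • JumpDiffusionOperator.generatorMatrix h𝒢 n) with hE
  simp only [Matrix.dotProduct_mulVec]
  refine (ae_eq_condExp_of_forall_setIntegral_eq (ℱ.le t) (hY.integrable_dotProduct h𝒢 s c)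
    (fun A _ _ => (hY.integrable_dotProduct h𝒢 t _).integrableOn) (fun A hA _ => ?_) ?_).symm
  · rw [hY.setIntegral_dotProduct h𝒢, hY.setIntegral_dotProduct h𝒢,
      hY.setIntegral_pow_eq_exp_mulVec h𝒢 n hts hA, Matrix.dotProduct_mulVec]
  · simp only [dotProduct_monomialVec_eq_eval]
    exact ((Polynomial.continuous _).comp_stronglyMeasurable
      (hY.stronglyAdapted t)).aestronglyMeasurable

end IsJumpDiffusion

/-! ### The matrices D and E and products of polynomials -/

theorem dupMatrix_mulVec (n : ℕ) (v : Fin (2 * n + 1) → ℝ) (i j : Fin (n + 1)) :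
    (dupMatrix n *ᵥ v) (j, i) = v ⟨i + j, by omega⟩ := by
  have h : ∀ k, dupMatrix n (j, i) k = if k = ⟨i + j, by omega⟩ then 1 else 0 := fun k => by
    simp only [dupMatrix, Matrix.sum_apply, Matrix.single_apply, Prod.mk.injEq]
    rw [Finset.sum_eq_single i, Finset.sum_eq_single j]
    · simp [eq_comm]
    · intro b _ hb; simp [hb]
    · simp
    · intro b _ hb; simp [hb]
    · simp
  simp [Matrix.mulVec, dotProduct, h]

/-- The first column of X_n(x) holds the powers 0 to n and the last row the powers n to 2n; x^n lies
in both and is taken from the column only. -/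
theorem elimMatrix_mulVec_hankelMatrix (n : ℕ) (x : ℝ) :
    elimMatrix n *ᵥ (hankelMatrix n x).vec = monomialVec (2 * n) x := by
  funext k
  simp only [elimMatrix, Matrix.add_mulVec, Matrix.sum_mulVec, Pi.add_apply, Finset.sum_apply,
    Matrix.single_mulVec, one_mul]
  rcases lt_or_ge (k : ℕ) (n + 1) with hk | hk
  · rw [Finset.sum_eq_single (⟨k, hk⟩ : Fin (n + 1)), Finset.sum_eq_zero]
    · simp [Matrix.vec, hankelMatrix, Matrix.vecMulVec_apply, monomialVec]
    · intro i _
      rw [Function.update_of_ne]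
      · rfl
      · intro h; have := congrArg Fin.val h; simp at this; omega
    · intro i _ hi
      rw [Function.update_of_ne]
      · rfl
      · intro h; exact hi (Fin.ext (by have := congrArg Fin.val h; simpa using this.symm))
    · simp
  · rw [Finset.sum_eq_zero, Finset.sum_eq_single (⟨k - (n + 1), by omega⟩ : Fin n)]
    · have e : (⟨n + 1 + (k - (n + 1)), by omega⟩ : Fin (2 * n + 1)) = k :=
        Fin.ext (by simp; omega)
      simp only [e, Function.update_self]
      simp only [Matrix.vec, hankelMatrix, Matrix.vecMulVec_apply, monomialVec, zero_add]
      rw [← pow_add]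
      congr 1
      simp
      omega
    · intro i _ hi
      rw [Function.update_of_ne]
      · rfl
      · intro h; exact hi (Fin.ext (by have := congrArg Fin.val h; simp at this; simp; omega))
    · simp
    · intro i _
      rw [Function.update_of_ne]
      · rfl
      · intro h; have := congrArg Fin.val h; simp at this; omega

/-- The coefficients, in degree at most `2 n`, of the product of two polynomials given by their
coefficients. -/
def mulCoeff {n : ℕ} (a b : Fin (n + 1) → ℝ) : Fin (2 * n + 1) → ℝ :=
  ∑ i : Fin (n + 1), ∑ j : Fin (n + 1), Pi.single ⟨i + j, by omega⟩ (a i * b j)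

/-- Both sides are the sum of a_i b_j v_{i+j}. Read this way, a linear functional of the product
becomes the bilinear form that D produces. -/
theorem mulCoeff_dotProduct {n : ℕ} (a b : Fin (n + 1) → ℝ) (v : Fin (2 * n + 1) → ℝ) :
    mulCoeff a b ⬝ᵥ v
      = a ⬝ᵥ (Matrix.of (fun i j : Fin (n + 1) => v ⟨i + j, by omega⟩) *ᵥ b) := by
  simp only [mulCoeff, sum_dotProduct, single_dotProduct]
  simp only [dotProduct, Matrix.mulVec, Matrix.of_apply, Finset.mul_sum]
  exact Finset.sum_congr rfl fun i _ => Finset.sum_congr rfl fun j _ => by ring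

theorem mulCoeff_dotProduct_monomialVec {n : ℕ} (a b : Fin (n + 1) → ℝ) (x : ℝ) :
    mulCoeff a b ⬝ᵥ monomialVec (2 * n) x = a ⬝ᵥ monomialVec n x * b ⬝ᵥ monomialVec n x := by
  rw [mulCoeff_dotProduct]
  simp only [dotProduct, Matrix.mulVec, Matrix.of_apply, monomialVec, pow_add]
  rw [Finset.sum_mul_sum]
  refine Finset.sum_congr rfl fun i _ => ?_
  rw [Finset.mul_sum]
  exact Finset.sum_congr rfl fun j _ => by ring

theorem vecInv_dupMatrix_mulVec (n : ℕ) (v : Fin (2 * n + 1) → ℝ) :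
    vecInv (dupMatrix n *ᵥ v)
      = Matrix.of (fun i j : Fin (n + 1) => v ⟨i + j, by omega⟩) := by
  ext i j
  exact dupMatrix_mulVec n v i j

end

/-! ### The two-point formula -/

theorem theorem3p9 {Ω : Type*} {mΩ : MeasurableSpace Ω} (P : Measure Ω) [IsProbabilityMeasure P]
    (ℱ : Filtration ℝ≥0 mΩ) (𝒢 : JumpDiffusionOperator) (h𝒢 : 𝒢.IsPolynomial)
    (Y : ℝ≥0 → Ω → ℝ) (y : ℝ) (hY : IsJumpDiffusion 𝒢 P ℱ Y y)
    (n₀ n₁ n : ℕ) (hn : n = max n₀ n₁)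
    (p₀ p₁ : Polynomial ℝ) (hp₀ : p₀ ∈ Polynomial.degreeLE ℝ n₀)
    (hp₁ : p₁ ∈ Polynomial.degreeLE ℝ n₁)
    (t s₀ s₁ : ℝ≥0) (hts : t < s₀) (hss : s₀ < s₁) :
    Integrable (fun ω => p₁.eval (Y s₀ ω) * p₀.eval (Y s₁ ω)) P ∧
    P[fun ω => p₁.eval (Y s₀ ω) * p₀.eval (Y s₁ ω) | ℱ t] =ᵐ[P] fun ω =>
      coeffVec n p₁ ⬝ᵥ
        ((vecInv ((dupMatrix n
              * NormedSpace.exp (((s₀ : ℝ) - t) • JumpDiffusionOperator.generatorMatrix h𝒢 (2 * n))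
              * elimMatrix n) *ᵥ (hankelMatrix n (Y t ω)).vec)
          * NormedSpace.exp (((s₁ : ℝ) - s₀) • (JumpDiffusionOperator.generatorMatrix h𝒢 n)ᵀ))
        *ᵥ coeffVec n p₀) := by
  have hp₀' : p₀ ∈ Polynomial.degreeLE ℝ n :=
    Polynomial.degreeLE_mono (by rw [hn]; exact_mod_cast le_max_left _ _) hp₀
  have hp₁' : p₁ ∈ Polynomial.degreeLE ℝ n :=
    Polynomial.degreeLE_mono (by rw [hn]; exact_mod_cast le_max_right _ _) hp₁
  have hm : ∀ (p : Polynomial ℝ) (s : ℝ≥0), StronglyMeasurable[ℱ s] fun ω => p.eval (Y s ω) :=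
    fun p s => p.continuous.comp_stronglyMeasurable (hY.stronglyAdapted s)
  have hint : Integrable (fun ω => p₁.eval (Y s₀ ω) * p₀.eval (Y s₁ ω)) P := by
    -- The majorant is |u v| ≤ u² + v², and both squares are polynomials in `Y`.
    refine ((hY.integrable_eval h𝒢 (p₁ ^ 2) s₀).add (hY.integrable_eval h𝒢 (p₀ ^ 2) s₁)).mono'
      (((hm p₁ s₀).mono (ℱ.le _)).mul ((hm p₀ s₁).mono (ℱ.le _))).aestronglyMeasurable
      (ae_of_all _ fun ω => ?_)
    simp only [Pi.add_apply, Polynomial.eval_pow, Real.norm_eq_abs]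
    rw [abs_le]
    constructor <;> nlinarith [sq_nonneg (p₁.eval (Y s₀ ω) + p₀.eval (Y s₁ ω)),
      sq_nonneg (p₁.eval (Y s₀ ω) - p₀.eval (Y s₁ ω))]
  refine ⟨hint, ?_⟩
  set w := NormedSpace.exp (((s₁ : ℝ) - s₀) • (JumpDiffusionOperator.generatorMatrix h𝒢 n)ᵀ)
    *ᵥ coeffVec n p₀ with hw
  have h0 : P[fun ω => p₀.eval (Y s₁ ω) | ℱ s₀] =ᵐ[P] fun ω => w ⬝ᵥ monomialVec n (Y s₀ ω) := by
    have := hY.condExp_dotProduct_monomialVec h𝒢 (coeffVec n p₀) hss.le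
    simp only [coeffVec_dotProduct_monomialVec hp₀'] at this
    refine this.trans (ae_of_all _ fun ω => ?_)
    simp only [hw]
    -- Moving the exponential onto the coefficients of p₀ transposes the generator matrix, whence
    -- the transpose in the formula.
    rw [← Matrix.transpose_smul, Matrix.exp_transpose, Matrix.mulVec_transpose,
      Matrix.dotProduct_mulVec]
  have h1 : P[fun ω => p₁.eval (Y s₀ ω) * p₀.eval (Y s₁ ω) | ℱ s₀] =ᵐ[P]
      fun ω => mulCoeff (coeffVec n p₁) w ⬝ᵥ monomialVec (2 * n) (Y s₀ ω) := by
    refine (condExp_mul_of_stronglyMeasurable_left (hm p₁ s₀) hint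
      (hY.integrable_eval h𝒢 p₀ s₁)).trans ?_
    filter_upwards [h0] with ω hω
    rw [Pi.mul_apply, hω, mulCoeff_dotProduct_monomialVec, coeffVec_dotProduct_monomialVec hp₁']
  -- The tower property reduces the claim to one conditional moment of degree at most 2n.
  have h2 := (condExp_condExp_of_le (f := fun ω => p₁.eval (Y s₀ ω) * p₀.eval (Y s₁ ω)) (μ := P)
    (ℱ.mono hts.le) (ℱ.le s₀)).symm.trans (condExp_congr_ae h1)
  refine h2.trans ((hY.condExp_dotProduct_monomialVec h𝒢 _ hts.le).trans
    (ae_of_all _ fun ω => ?_))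
  simp only
  rw [← Matrix.mulVec_mulVec, ← Matrix.mulVec_mulVec, ← Matrix.mulVec_mulVec,
    elimMatrix_mulVec_hankelMatrix, vecInv_dupMatrix_mulVec, mulCoeff_dotProduct]
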